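/- Work in the unit-cost word RAM with words of $W=\max(w,\ell(n))$ bits, where $\ell(n)$ is the length of the binary expansion of $n$ (instructions: constants, addition, subtraction, multiplication, bitwise AND/OR/XOR, shifts by arbitrary amounts, indirect memory reads and writes, comparison jumps; a randomized program can moreover draw uniformly random words). A family $\Pi=(\pi_s)_{s\in K}$ of permutations of a finite set $D$ is called \emph{$k$-wise $\delta$-dependent} if for all distinct $x_1,\dots,x_k\in D$ the distribution of $(\pi_s(x_1),\dots,\pi_s(x_k))$, for $s\in K$ uniformly random, has statistical distance at most $\delta$ from the distribution of $(\sigma(x_1),\dots,\sigma(x_k))$, for $\sigma$ a uniformly random permutation of $D$. For every constant $C>0$ there are constants $0<\alpha<\beta<1$ such that for every constant $c>1$ there are a randomized program (the generator), a deterministic program (the evaluator), a polynomial $p$ and constants $t,n_0$ such that for all integers $n\ge n_0$ and $0\le w\le C\log_2 n$, with $k=\lfloor n^{\alpha}\rfloor$ and $\delta=\frac{k^2}{2^{w/2}}+\frac{k^2}{2^{w}}$, the following holds. On input $(n,w)$, for every outcome of its random choices, the generator halts within $p(n)$ steps and outputs a collection $\Pi$ of permutations of $\{0,1\}^w$, given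 by a list of words shared by all members together with a key length, the members $\pi_s$ being indexed by all keys $s$ of this length (in words). Moreover: \begin{enumerate} \item With probability at least $1-n^{-c}$ over the random choices of the generator, the collection $\Pi$ is $k$-wise $\delta$-dependent. \item For every outcome of the random choices, every $\pi_s\in\Pi$ is represented by at most $n^{\beta}$ bits (the shared words followed by the key $s$), and from this representation in memory and any $x\in\{0,1\}^w$ the evaluator computes $\pi_s(x)$ in at most $t$ steps. \end{enumerate} -/

import Mathlib

/-! ### Probability over finite uniform spaces, statistical distance -/

/-- Probability of the event `p` when `ω` is drawn uniformly from the finite type `Ω`. -/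
noncomputable def unifProb {Ω : Type*} [Fintype Ω] (p : Ω → Prop) : ℝ :=
  open Classical in ((Finset.univ.filter p).card : ℝ) / (Fintype.card Ω : ℝ)

/-- Statistical (total variation) distance between the random variables `X`, `Y`, each defined on
its own uniform finite probability space. -/
noncomputable def statDist {Ω Ω' B : Type*} [Fintype Ω] [Fintype Ω'] [Fintype B]
    (X : Ω → B) (Y : Ω' → B) : ℝ :=
  (1 / 2) * ∑ b : B, |unifProb (fun ω => X ω = b) - unifProb (fun ω => Y ω = b)|

/-- A family of permutations of a finite set `D`, indexed by `K`, is `k`-wise `δ`-dependent: for all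
distinct `x₁, …, x_k`, the tuple of images under a uniformly chosen member of the family is
`δ`-close to the tuple of images under a truly random permutation of `D`. -/
def KWiseDependent {K D : Type*} [Fintype K] [Fintype D] [DecidableEq D]
    (k : ℕ) (δ : ℝ) (π : K → Equiv.Perm D) : Prop :=
  ∀ x : Fin k → D, Function.Injective x →
    statDist (fun s : K => fun i => π s (x i)) (fun σ : Equiv.Perm D => fun i => σ (x i)) ≤ δ

/-! ### The unit cost RAM with words of `W` bits -/

namespace WordRAM

/-- The binary operations on words: addition, subtraction and multiplication modulo `2 ^ W`,
bitwise Boolean operations, and shifts by an arbitrary number of positions. -/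
inductive Op
  | add | sub | mul | and | or | xor | shl | shr

def Op.apply {W : ℕ} : Op → BitVec W → BitVec W → BitVec W
  | .add, x, y => x + y
  | .sub, x, y => x - y
  | .mul, x, y => x * y
  | .and, x, y => x &&& y
  | .or, x, y => x ||| y
  | .xor, x, y => x ^^^ y
  | .shl, x, y => x <<< y.toNat
  | .shr, x, y => x >>> y.toNat

/-- Instructions. The arguments `r`, `a`, `b` are register numbers.
* `const r c`: put the constant `c` (modulo `2 ^ W`) into register `r`;
* `rand r`: put the next word of the random tape into register `r`;
* `op o r a b`: apply `o` to registers `a`, `b`, and put the result into register `r`;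
* `load r a`: put the memory cell addressed by register `a` into register `r`;
* `store a r`: put register `r` into the memory cell addressed by register `a`;
* `jumpLt a b l`: if register `a` is smaller than register `b` (as unsigned numbers), continue with
  instruction number `l`. -/
inductive Instr
  | const (r c : ℕ)
  | rand (r : ℕ)
  | op (o : Op) (r a b : ℕ)
  | load (r a : ℕ)
  | store (a r : ℕ)
  | jumpLt (a b l : ℕ)

/-- A program is a fixed finite list of instructions, independent of the word length. -/
abbrev Program := List Instr

structure State (W : ℕ) where
  /-- number of the next instruction -/
  pc : ℕ
  /-- number of words of the random tape read so far -/
  used : ℕ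
  reg : ℕ → BitVec W
  mem : BitVec W → BitVec W

/-- One step, at unit cost. The machine has halted when `pc` is not the number of an instruction. -/
def step {W : ℕ} (P : Program) (tape : ℕ → BitVec W) (s : State W) : State W :=
  match P[s.pc]? with
  | none => s
  | some (.const r c) =>
      { s with pc := s.pc + 1, reg := Function.update s.reg r (BitVec.ofNat W c) }
  | some (.rand r) =>
      { s with pc := s.pc + 1, used := s.used + 1, reg := Function.update s.reg r (tape s.used) }
  | some (.op o r a b) =>
      { s with pc := s.pc + 1, reg := Function.update s.reg r (o.apply (s.reg a) (s.reg b)) }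
  | some (.load r a) =>
      { s with pc := s.pc + 1, reg := Function.update s.reg r (s.mem (s.reg a)) }
  | some (.store a r) =>
      { s with pc := s.pc + 1, mem := Function.update s.mem (s.reg a) (s.reg r) }
  | some (.jumpLt a b l) =>
      { s with pc := if (s.reg a).toNat < (s.reg b).toNat then l else s.pc + 1 }

/-- The state after `t` steps. -/
def run {W : ℕ} (P : Program) (tape : ℕ → BitVec W) (t : ℕ) (s : State W) : State W :=
  (step P tape)^[t] s

def Halted {W : ℕ} (P : Program) (s : State W) : Prop := P.length ≤ s.pc

/-- Initial state: inputs `x`, `y` in registers `0`, `1`, all other registers zero, the memory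
holding the words of the list `m` in its cells `0, 1, …`, and zeros elsewhere. -/
def init {W : ℕ} (x y : BitVec W) (m : List (BitVec W)) : State W where
  pc := 0
  used := 0
  reg := fun i => if i = 0 then x else if i = 1 then y else 0
  mem := fun a => m.getD a.toNat 0

/-- A random tape with `T` random words. A machine that makes at most `T` steps never reads beyond
it. -/
def extendTape {W T : ℕ} (r : Fin T → BitVec W) (i : ℕ) : BitVec W :=
  if h : i < T then r ⟨i, h⟩ else 0

/-- Word length for the parameters `n` and `w`: just enough for a word to hold the number `n` and to
hold an element of `{0,1}^w`. -/
def wordLength (n w : ℕ) : ℕ := max w n.size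

/-- A described collection of permutations of `{0,1}^w`: words `shared` that are common to all
members, and one permutation for each key of `keyLen` words. -/
structure PermCollection (W w : ℕ) where
  shared : List (BitVec W)
  keyLen : ℕ
  perm : (Fin keyLen → BitVec W) → Equiv.Perm (BitVec w)

namespace PermCollection

variable {W w : ℕ}

/-- The complete representation of the member with key `s`, including the shared words. -/
def repr (F : PermCollection W w) (s : Fin F.keyLen → BitVec W) : List (BitVec W) :=
  F.shared ++ List.ofFn s

/-- Number of bits of the complete representation of any one member. -/
def reprBits (F : PermCollection W w) : ℕ := (F.shared.length + F.keyLen) * W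

/-- `P` evaluates every member of the collection on every point within `t` steps: started with the
representation of the permutation in memory and `x` in register `0`, it halts with the value in
register `0`. No random words are provided. -/
def EvaluatedBy (F : PermCollection W w) (P : Program) (t : ℕ) : Prop :=
  ∀ (s : Fin F.keyLen → BitVec W) (x : BitVec w),
    let f := run P (fun _ => 0) t (init (x.setWidth W) 0 (F.repr s))
    Halted P f ∧ f.reg 0 = (F.perm s x).setWidth W

/-- The state `f` outputs the collection: register `0` holds the number of shared words, register
`1` the number of words in a key, and the shared words are in the memory cells `0, 1, …`. -/
def OutputIn (F : PermCollection W w) (f : State W) : Prop :=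
  F.shared = List.ofFn (fun i : Fin (f.reg 0).toNat => f.mem (BitVec.ofNat W i)) ∧
    F.keyLen = (f.reg 1).toNat

end PermCollection

/-- On input `(n, w)` and random words `r`, the program `P` halts within `T` steps and outputs the
collection `F`. -/
def Outputs {n w T : ℕ} (P : Program) (r : Fin T → BitVec (wordLength n w))
    (F : PermCollection (wordLength n w) w) : Prop :=
  let f := run P (extendTape r) T (init (BitVec.ofNat _ n) (BitVec.ofNat _ w) [])
  Halted P f ∧ F.OutputIn f

end WordRAM

/-!
The permutations are built from five Feistel rounds, in each of which some bits of the word are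
modified by a hash function of the remaining bits. The hash functions are `k`-wise independent and
evaluated in constant time by Siegel's method; the randomness of the generator is used for the graph
on which this method rests.

**Hash functions.** A word of `w ≤ C log₂ n` bits is cut into `q = O(1)` characters of
`⌊log₂ n⌋ / 2` bits. The generator draws a random bipartite graph of constant degree `2 d`, with the
characters on the left and, for each edge label, `2 ^ g ≈ n ^ (1 / (2 q))` vertices on the right.
Every nonempty set of at most `k = ⌊n ^ α⌋` characters then has a neighbour that belongs to one of
them only, except with probability `n ^ (-c)` if `d` is large in terms of `c`
(`unifProb_not_hasUniqueNeighbors_le`): a map without fibres of size one on a set of size `s` has at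
most `s / 2` values, and there are few such maps. Unique neighbours pass on to the `q`-th power of
the graph (`HasUniqueNeighbors.pi`), whose left vertices are words. If every right vertex of the
power carries a random word of the key, the sums over the neighbours of up to `k` given left
vertices are independent and uniform, since the word at a unique neighbour can be used to adjust one
sum without affecting the others (`HasUniqueNeighbors.kWiseUniform`).

**Permutations.** For a Feistel network with two halves, collisions in the smaller half are slightly
too likely for the bound `δ` if `w` is odd. So the bits are divided into three parts `A`, `B`, `C` of
about `w / 4`, `w / 4` and `w / 2` bits, and the rounds modify `A`, then `B` and `C`, then `A`, `B`,
`C` one after the other. If in the last three rounds the round functions are never applied to the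
same input for two of the `k` words, then all outcomes have the probability they would have for
independent uniform words (`KWiseUniform.lastRounds`). Whether this is so depends only on the first
two rounds and on the outcome, and for the outcome of a random permutation it fails for a given pair
of words with probability at most `2 ^ (-w / 2)` if `w ≥ 16` (`KWiseUniform.collision_le`,
`collision_bound`); for shorter words `δ ≥ 1`. A pointwise comparison of the two distributions then
bounds the statistical distance (`statDist_le_average`); the term `k ^ 2 / 2 ^ w` of `δ` accounts for
the difference between a random permutation and independent uniform words.

**Programs.** The evaluator is straight-line code compiled from an expression over the memory
(`Expr.run_program`), of a size that depends only on `q` and `d`; that its value is the permutation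
is `eval_permExpr`. The generator computes `⌊log₂ n⌋` in a loop, stores it together with `w`, and
copies random words to the memory in a second loop (`run_genProgram`).
-/

/-! ### Uniform probability -/

section UniformProbability

variable {Ω Ω' : Type*} [Fintype Ω] [Fintype Ω']

theorem unifProb_eq_card (p : Ω → Prop) [DecidablePred p] :
    unifProb p = ((Finset.univ.filter p).card : ℝ) / Fintype.card Ω := by
  unfold unifProb
  congr!

theorem unifProb_nonneg (p : Ω → Prop) : 0 ≤ unifProb p := by
  unfold unifProb; positivity

theorem unifProb_mono {p p' : Ω → Prop} (h : ∀ ω, p ω → p' ω) : unifProb p ≤ unifProb p' := by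
  classical
  unfold unifProb
  gcongr with ω
  exact h ω

theorem unifProb_le_one (p : Ω → Prop) : unifProb p ≤ 1 := by
  classical
  unfold unifProb
  refine div_le_one_of_le₀ ?_ (by positivity)
  exact_mod_cast Finset.card_le_univ _

theorem unifProb_congr {p p' : Ω → Prop} (h : ∀ ω, p ω ↔ p' ω) : unifProb p = unifProb p' :=
  congrArg unifProb (funext fun ω => propext (h ω))

theorem unifProb_of_forall [Nonempty Ω] {p : Ω → Prop} (h : ∀ ω, p ω) : unifProb p = 1 := by
  classical
  unfold unifProb
  rw [Finset.filter_true_of_mem (fun ω _ => h ω), Finset.card_univ]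
  exact div_self (by exact_mod_cast Fintype.card_ne_zero)

theorem unifProb_of_forall_not {p : Ω → Prop} (h : ∀ ω, ¬ p ω) : unifProb p = 0 := by
  classical
  unfold unifProb
  rw [Finset.filter_false_of_mem (fun ω _ => h ω)]
  simp

theorem unifProb_eq_sum (p : Ω → Prop) [DecidablePred p] :
    unifProb p = (∑ ω, if p ω then (1 : ℝ) else 0) / Fintype.card Ω := by
  unfold unifProb
  rw [Finset.sum_boole]
  congr!

theorem unifProb_or_le (p p' : Ω → Prop) :
    unifProb (fun ω => p ω ∨ p' ω) ≤ unifProb p + unifProb p' := by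
  classical
  rw [unifProb_eq_card, unifProb_eq_card p, unifProb_eq_card p', ← add_div, Finset.filter_or]
  gcongr
  exact_mod_cast Finset.card_union_le _ _

theorem unifProb_exists_mem_le {ι : Type*} (s : Finset ι) (p : ι → Ω → Prop) :
    unifProb (fun ω => ∃ i ∈ s, p i ω) ≤ ∑ i ∈ s, unifProb (p i) := by
  classical
  induction s using Finset.induction_on with
  | empty => simp [unifProb_of_forall_not]
  | insert i s hi ih =>
    rw [Finset.sum_insert hi]
    refine le_trans (le_trans (unifProb_mono ?_) (unifProb_or_le (p i) (fun ω => ∃ i ∈ s, p i ω)))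
      (by gcongr)
    intro ω ⟨j, hj, h⟩
    rcases Finset.mem_insert.1 hj with rfl | hj
    · exact Or.inl h
    · exact Or.inr ⟨j, hj, h⟩

theorem unifProb_add_not [Nonempty Ω] (p : Ω → Prop) :
    unifProb p + unifProb (fun ω => ¬ p ω) = 1 := by
  classical
  unfold unifProb
  rw [← add_div]
  have := Finset.card_filter_add_card_filter_not (s := (Finset.univ : Finset Ω)) p
  rw [Finset.card_univ] at this
  rw [div_eq_one_iff_eq (by exact_mod_cast Fintype.card_ne_zero)]
  rw [← this]
  push_cast
  congr!

theorem unifProb_comp_equiv (f : Ω ≃ Ω') (p : Ω' → Prop) :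
    unifProb (fun ω => p (f ω)) = unifProb p := by
  classical
  rw [unifProb_eq_sum, unifProb_eq_sum, Fintype.card_congr f]
  congr 1
  exact Equiv.sum_comp f (fun ω => if p ω then (1 : ℝ) else 0)

/-- The probability of an event in a product space is the average over the first coordinate. -/
theorem unifProb_prod (p : Ω × Ω' → Prop) :
    unifProb p = (∑ ω, unifProb fun ω' => p (ω, ω')) / Fintype.card Ω := by
  classical
  simp_rw [unifProb_eq_sum]
  rw [← Finset.sum_div, ← Fintype.sum_prod_type', Fintype.card_prod, Nat.cast_mul, div_div,
    mul_comm (Fintype.card Ω : ℝ)]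

theorem unifProb_prod_le (p : Ω × Ω' → Prop) {ε : ℝ} (hε : 0 ≤ ε)
    (h : ∀ ω, unifProb (fun ω' => p (ω, ω')) ≤ ε) : unifProb p ≤ ε := by
  rw [unifProb_prod]
  refine div_le_of_le_mul₀ (by positivity) hε ?_
  refine (Finset.sum_le_sum fun ω _ => h ω).trans ?_
  simp [mul_comm]

/-- If, for all first coordinates satisfying `p`, the event `p'` has conditional probability at
least `c`, then it has probability at least `unifProb p * c`. -/
theorem unifProb_mul_le_prod (p : Ω → Prop) (p' : Ω × Ω' → Prop) {c : ℝ}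
    (h : ∀ ω, p ω → c ≤ unifProb (fun ω' => p' (ω, ω'))) : unifProb p * c ≤ unifProb p' := by
  classical
  rw [unifProb_prod, unifProb_eq_sum, div_mul_eq_mul_div, Finset.sum_mul]
  gcongr with ω
  split_ifs with hp
  · simpa using h ω hp
  · simpa using unifProb_nonneg _

theorem unifProb_prod_and (p : Ω → Prop) (p' : Ω' → Prop) :
    unifProb (fun ω : Ω × Ω' => p ω.1 ∧ p' ω.2) = unifProb p * unifProb p' := by
  classical
  rw [unifProb_prod, unifProb_eq_sum p, div_mul_eq_mul_div, Finset.sum_mul]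
  congr 1
  refine Finset.sum_congr rfl fun ω _ => ?_
  by_cases hp : p ω
  · simp [hp]
  · simp [hp, unifProb_of_forall_not]

theorem unifProb_prod_fst [Nonempty Ω'] (p : Ω → Prop) :
    unifProb (fun ω : Ω × Ω' => p ω.1) = unifProb p := by
  have := unifProb_prod_and p (fun _ : Ω' => True)
  simpa [unifProb_of_forall] using this

theorem unifProb_prod_snd [Nonempty Ω] (p : Ω' → Prop) :
    unifProb (fun ω : Ω × Ω' => p ω.2) = unifProb p := by
  have := unifProb_prod_and (fun _ : Ω => True) p
  simpa [unifProb_of_forall] using this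

theorem unifProb_pi_forall {ι : Type*} [Fintype ι] [DecidableEq ι] (p : Ω → Prop) :
    unifProb (fun ω : ι → Ω => ∀ i, p (ω i)) = unifProb p ^ Fintype.card ι := by
  classical
  rw [unifProb_eq_card, unifProb_eq_card p]
  have : (Finset.univ.filter fun ω : ι → Ω => ∀ i, p (ω i)) =
      Fintype.piFinset fun _ => Finset.univ.filter p := by
    ext ω; simp [Fintype.mem_piFinset]
  rw [this, Fintype.card_piFinset, Fintype.card_pi, div_pow]
  simp

/-- A surjective homomorphism of finite groups maps the uniform distribution to the uniform
distribution. -/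
theorem unifProb_comp_surjective {G H : Type*} [AddGroup G] [AddGroup H] [Fintype G] [Fintype H]
    (φ : G →+ H) (hφ : Function.Surjective φ) (p : H → Prop) :
    unifProb (fun x => p (φ x)) = unifProb p := by
  classical
  have hc : ∀ y, (Finset.univ.filter fun x => φ x = y).card =
      (Finset.univ.filter fun x => φ x = 0).card := fun y =>
    AddMonoidHom.card_fiber_eq_of_mem_range φ (hφ y) (hφ 0)
  set c := (Finset.univ.filter fun x => φ x = 0).card with hc0
  have h1 : ∀ p : H → Prop, (Finset.univ.filter fun x => p (φ x)).card =
      (Finset.univ.filter p).card * c := by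
    intro p
    rw [Finset.card_eq_sum_card_fiberwise (f := φ) (t := Finset.univ.filter p)
      (fun x hx => by simpa using hx)]
    rw [Finset.sum_const_nat (m := c)]
    intro y hy
    rw [← hc y]
    congr 1
    ext x
    simp only [Finset.mem_filter, Finset.mem_univ, true_and, and_iff_right_iff_imp] at hy ⊢
    rintro rfl
    exact hy
  have h2 := h1 (fun _ => True)
  simp only [Finset.filter_true, Finset.card_univ] at h2
  have hcpos : (c : ℝ) ≠ 0 := by
    have : 0 < c := Finset.card_pos.2 ⟨0, by simp⟩
    exact_mod_cast this.ne'
  have hp := h1 p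
  unfold unifProb
  rw [h2]
  convert_to (((Finset.univ.filter fun x => p (φ x)).card : ℕ) : ℝ) / _ = _
  rw [hp]
  push_cast
  rw [mul_div_mul_right _ _ hcpos]

theorem sum_unifProb_eq {B : Type*} [Fintype B] [Nonempty Ω] (X : Ω → B) :
    ∑ b, unifProb (fun ω => X ω = b) = 1 := by
  classical
  simp_rw [unifProb_eq_sum]
  rw [← Finset.sum_div, Finset.sum_comm]
  simp

theorem sum_unifProb_mul {B : Type*} [Fintype B] (X : Ω → B) (f : B → ℝ) :
    ∑ b, unifProb (fun ω => X ω = b) * f b = (∑ ω, f (X ω)) / Fintype.card Ω := by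
  classical
  simp_rw [unifProb_eq_sum, div_mul_eq_mul_div]
  rw [← Finset.sum_div]
  congr 1
  simp_rw [Finset.sum_mul]
  rw [Finset.sum_comm]
  refine Finset.sum_congr rfl fun ω _ => ?_
  simp

/-- A pointwise comparison of two distributions bounds their statistical distance: it suffices that
no value `b` is much less likely under `X` than under `Y`, and the relative defect `ε b` counts only
with the probability of `b` under `Y`. -/
theorem statDist_le_average {B : Type*} [Fintype B] [Nonempty Ω] [Nonempty Ω']
    (X : Ω → B) (Y : Ω' → B) (ε : B → ℝ) (hε : ∀ b, 0 ≤ ε b)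
    (h : ∀ ω', unifProb (fun ω => Y ω = Y ω') * (1 - ε (Y ω')) ≤ unifProb (fun ω => X ω = Y ω')) :
    statDist X Y ≤ (∑ ω', ε (Y ω')) / Fintype.card Ω' := by
  classical
  rw [← sum_unifProb_mul Y ε]
  have hX := sum_unifProb_eq X
  have hY := sum_unifProb_eq Y
  have key : ∀ b, |unifProb (fun ω => X ω = b) - unifProb (fun ω => Y ω = b)| ≤
      unifProb (fun ω => X ω = b) - unifProb (fun ω => Y ω = b) +
        2 * (unifProb (fun ω => Y ω = b) * ε b) := by
    intro b
    have h0 : 0 ≤ unifProb (fun ω => Y ω = b) * ε b := mul_nonneg (unifProb_nonneg _) (hε b)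
    have h1 : unifProb (fun ω => Y ω = b) * (1 - ε b) ≤ unifProb (fun ω => X ω = b) := by
      by_cases hb : ∃ ω', Y ω' = b
      · obtain ⟨ω', rfl⟩ := hb
        exact h ω'
      · rw [unifProb_of_forall_not (p := fun ω => Y ω = b) (fun ω hω => hb ⟨ω, hω⟩)]
        simpa using unifProb_nonneg _
    rw [abs_le]
    constructor <;> nlinarith
  unfold statDist
  have := Finset.sum_le_sum fun b (_ : b ∈ Finset.univ) => key b
  rw [Finset.sum_add_distrib, Finset.sum_sub_distrib, hX, hY, ← Finset.mul_sum] at this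
  linarith

theorem statDist_le_one {B : Type*} [Fintype B] [Nonempty Ω] [Nonempty Ω']
    (X : Ω → B) (Y : Ω' → B) : statDist X Y ≤ 1 := by
  refine (statDist_le_average X Y (fun _ => 1) (fun _ => zero_le_one) fun ω' => ?_).trans ?_
  · simpa using unifProb_nonneg _
  · simp

end UniformProbability

/-! ### Random permutations -/

section RandomPermutation

variable {D : Type*} [Fintype D] [DecidableEq D]

theorem exists_perm_comp_eq {k : ℕ} {x y : Fin k → D} (hx : Function.Injective x)
    (hy : Function.Injective y) : ∃ τ : Equiv.Perm D, ∀ i, τ (x i) = y i := by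
  classical
  refine ⟨Equiv.extendSubtype (p := (· ∈ Set.range x)) (q := (· ∈ Set.range y))
    ((Equiv.ofInjective x hx).symm.trans (Equiv.ofInjective y hy)), fun i => ?_⟩
  rw [Equiv.extendSubtype_apply_of_mem _ _ ⟨i, rfl⟩]
  have : (⟨x i, ⟨i, rfl⟩⟩ : Set.range x) = Equiv.ofInjective x hx i := rfl
  rw [Equiv.trans_apply, this, Equiv.symm_apply_apply]
  rfl

/-- A random permutation maps a tuple of distinct points to each tuple of distinct points with the
same probability. -/
theorem unifProb_perm_tuple {k : ℕ} {x y : Fin k → D} (hx : Function.Injective x)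
    (hy : Function.Injective y) :
    unifProb (fun σ : Equiv.Perm D => (fun i => σ (x i)) = y) *
      (Fintype.card D).descFactorial k = 1 := by
  classical
  have hsym : ∀ e : Fin k ↪ D,
      unifProb (fun σ : Equiv.Perm D => (⟨x, hx⟩ : Fin k ↪ D).trans σ.toEmbedding = e) =
      unifProb (fun σ : Equiv.Perm D => (fun i => σ (x i)) = y) := by
    intro e
    obtain ⟨τ, hτ⟩ := exists_perm_comp_eq e.injective hy
    rw [← unifProb_comp_equiv (Equiv.mulLeft τ) fun σ : Equiv.Perm D => (fun i => σ (x i)) = y]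
    refine unifProb_congr fun σ => ?_
    simp only [DFunLike.ext_iff, funext_iff, Equiv.coe_mulLeft, Equiv.Perm.mul_apply, ← hτ,
      EmbeddingLike.apply_eq_iff_eq]
    rfl
  have hsum := sum_unifProb_eq
    (fun σ : Equiv.Perm D => (⟨x, hx⟩ : Fin k ↪ D).trans σ.toEmbedding)
  rw [Finset.sum_congr rfl (fun e _ => hsym e), Finset.sum_const, Finset.card_univ,
    Fintype.card_embedding_eq, Fintype.card_fin, nsmul_eq_mul] at hsum
  rw [mul_comm]
  exact hsum

theorem one_sub_mul_pow_le_descFactorial {N k : ℕ} (hk : k ≤ N) (hN : 0 < N) :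
    (1 - (k : ℝ) ^ 2 / N) * (N : ℝ) ^ k ≤ N.descFactorial k := by
  have hN' : (0 : ℝ) < N := by exact_mod_cast hN
  induction k with
  | zero => simp
  | succ k ih =>
    have ih := ih (by omega)
    have hk' : (k : ℝ) + 1 ≤ N := by exact_mod_cast hk
    rw [Nat.descFactorial_succ, Nat.cast_mul, Nat.cast_sub (by omega)]
    have h1 : ((N : ℝ) - k) * ((1 - (k : ℝ) ^ 2 / N) * (N : ℝ) ^ k) ≤
        ((N : ℝ) - k) * N.descFactorial k := by
      refine mul_le_mul_of_nonneg_left ih (by linarith)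
    refine le_trans ?_ h1
    have h2 : (1 - ((k + 1 : ℕ) : ℝ) ^ 2 / N) * (N : ℝ) ≤
        ((N : ℝ) - k) * (1 - (k : ℝ) ^ 2 / N) := by
      have : (N : ℝ) * ((k : ℝ) ^ 2 / N) = k ^ 2 := by field_simp
      have h3 : (N : ℝ) * (((k + 1 : ℕ) : ℝ) ^ 2 / N) = (k + 1) ^ 2 := by
        push_cast; field_simp
      have h4 : 0 ≤ (k : ℝ) * ((k : ℝ) ^ 2 / N) := by positivity
      have h5 : (0 : ℝ) ≤ k := by positivity
      nlinarith
    calc _ = ((1 - ((k + 1 : ℕ) : ℝ) ^ 2 / N) * (N : ℝ)) * (N : ℝ) ^ k := by ring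
      _ ≤ (((N : ℝ) - k) * (1 - (k : ℝ) ^ 2 / N)) * (N : ℝ) ^ k := by gcongr
      _ = _ := by ring

/-- The images of distinct points under a random permutation are not much more likely to be equal
to given points than independent uniform points are. -/
theorem unifProb_perm_tuple_mul_le {k : ℕ} {x y : Fin k → D} (hx : Function.Injective x)
    (hy : Function.Injective y) (hD : 0 < Fintype.card D) :
    unifProb (fun σ : Equiv.Perm D => (fun i => σ (x i)) = y) *
      (1 - (k : ℝ) ^ 2 / Fintype.card D) ≤ ((Fintype.card D : ℝ) ^ k)⁻¹ := by
  have hk : k ≤ Fintype.card D := by simpa using Fintype.card_le_of_injective x hx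
  have h1 := unifProb_perm_tuple hx hy
  have h2 := one_sub_mul_pow_le_descFactorial hk hD
  have hD' : (0 : ℝ) < Fintype.card D := by exact_mod_cast hD
  rw [← one_div, le_div_iff₀ (by positivity), mul_assoc]
  refine le_trans ?_ h1.le
  exact mul_le_mul_of_nonneg_left h2 (unifProb_nonneg _)

/-- Two distinct points collide under `f ∘ σ`, for a random permutation `σ`, at most as often as
two independent uniform points collide under `f`, if these collide with probability at most
`F / card D` even when one of them is fixed. By symmetry the collision probability `ρ` does not
depend on the two points, and a given point collides with fewer than `F` others. -/
theorem unifProb_perm_collision_mul_le {E : Type*} (f : D → E) (F : ℕ)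
    (hF : ∀ u, unifProb (fun v => f v = f u) ≤ F / Fintype.card D) (hFD : F ≤ Fintype.card D)
    {x y : D} (hxy : x ≠ y) :
    unifProb (fun σ : Equiv.Perm D => f (σ x) = f (σ y)) ≤ F / Fintype.card D := by
  classical
  have : Nonempty D := ⟨x⟩
  have hN : (1 : ℝ) < Fintype.card D := by
    exact_mod_cast Fintype.one_lt_card_iff.2 ⟨x, y, hxy⟩
  set ρ := unifProb (fun σ : Equiv.Perm D => f (σ x) = f (σ y)) with hρ
  have hsym : ∀ z ∈ Finset.univ.erase x,
      unifProb (fun σ : Equiv.Perm D => f (σ x) = f (σ z)) = ρ := by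
    intro z hz
    have hz : z ≠ x := Finset.ne_of_mem_erase hz
    rw [hρ, ← unifProb_comp_equiv (Equiv.mulRight (Equiv.swap y z))]
    refine unifProb_congr fun σ => ?_
    simp [Equiv.swap_apply_of_ne_of_ne hxy hz.symm]
  have htot : ∑ z, unifProb (fun σ : Equiv.Perm D => f (σ x) = f (σ z)) ≤ F := by
    simp_rw [unifProb_eq_sum]
    rw [← Finset.sum_div, Finset.sum_comm]
    refine div_le_of_le_mul₀ (by positivity) (by positivity) ?_
    refine (Finset.sum_le_sum (g := fun _ => (F : ℝ)) fun σ _ => ?_).trans (by simp [mul_comm])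
    have h := hF (σ x)
    rw [unifProb_eq_sum, div_le_div_iff_of_pos_right (by linarith)] at h
    refine le_trans (le_of_eq ?_) h
    rw [← Equiv.sum_comp σ fun v => if f v = f (σ x) then (1 : ℝ) else 0]
    exact Finset.sum_congr rfl fun z _ => by simp [eq_comm]
  rw [← Finset.add_sum_erase _ _ (Finset.mem_univ x), unifProb_of_forall (fun _ => rfl),
    Finset.sum_congr rfl hsym, Finset.sum_const, Finset.card_erase_of_mem (Finset.mem_univ x),
    Finset.card_univ, nsmul_eq_mul, Nat.cast_sub (by exact_mod_cast hN.le), Nat.cast_one] at htot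
  rw [le_div_iff₀ (by linarith)]
  have hFD' : (F : ℝ) ≤ Fintype.card D := by exact_mod_cast hFD
  have hρ0 : 0 ≤ ρ := unifProb_nonneg _
  have hρ1 : ρ ≤ 1 := unifProb_le_one _
  nlinarith

end RandomPermutation

/-! ### Masks -/

section Mask

variable {w : ℕ}

instance : Nonempty (BitVec w) := ⟨0⟩

theorem card_bitVec (w : ℕ) : Fintype.card (BitVec w) = 2 ^ w := by
  rw [Fintype.card_congr (BitVec.equivFin (m := w)).toEquiv, Fintype.card_fin]

/-- The probability that a uniformly random word vanishes on the bits of the mask `N`. -/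
noncomputable def maskProb (N : BitVec w) : ℝ := unifProb fun u : BitVec w => u &&& N = 0

/-- Adding a fixed word bit by bit, as a permutation. -/
def xorEquiv (v : BitVec w) : BitVec w ≃ BitVec w :=
  Function.Involutive.toPerm (fun u => u ^^^ v) fun u => by simp

@[simp] theorem xorEquiv_apply (v u : BitVec w) : xorEquiv v u = u ^^^ v := rfl

theorem xor_and_eq_zero_iff (u v N : BitVec w) : (u ^^^ v) &&& N = 0 ↔ u &&& N = v &&& N := by
  have : (u ^^^ v) &&& N = (u &&& N) ^^^ (v &&& N) := by
    ext i hi; simp only [BitVec.getElem_and, BitVec.getElem_xor]; grind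
  rw [this]
  exact BitVec.xor_eq_zero_iff

theorem unifProb_and_eq (v N : BitVec w) :
    unifProb (fun u : BitVec w => u &&& N = v &&& N) = maskProb N := by
  rw [maskProb, ← unifProb_comp_equiv (xorEquiv v) fun u => u &&& N = 0]
  exact unifProb_congr fun u => by rw [xorEquiv_apply, xor_and_eq_zero_iff]

theorem maskProb_nonneg (N : BitVec w) : 0 ≤ maskProb N := unifProb_nonneg _

/-- Words as functions on the set of positions. -/
def bitsEquiv (w : ℕ) : BitVec w ≃ (Fin w → Bool) where
  toFun u i := u[i]
  invFun f := BitVec.ofFnLE f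
  left_inv u := by ext i hi; simp
  right_inv f := by ext i; simp

theorem maskProb_eq (N : BitVec w) :
    maskProb N = (1 / 2) ^ (Finset.univ.filter fun i : Fin w => N[i] = true).card := by
  classical
  have h1 : maskProb N = unifProb fun f : Fin w → Bool => ∀ i, N[i] = true → f i = false := by
    rw [maskProb, ← unifProb_comp_equiv (bitsEquiv w)]
    refine unifProb_congr fun u => ?_
    constructor
    · intro h i hi
      have := congrArg (fun v : BitVec w => v[i]) h
      change u[i] = false
      simp only [Fin.getElem_fin, BitVec.getElem_and, BitVec.ofNat_eq_ofNat,
        BitVec.getElem_zero] at this hi ⊢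
      simpa [hi] using this
    · intro h
      ext i hi
      have := h ⟨i, hi⟩
      simp only [bitsEquiv, Equiv.coe_fn_mk, Fin.getElem_fin] at this
      simp only [BitVec.getElem_and, BitVec.ofNat_eq_ofNat, BitVec.getElem_zero]
      cases hN : N[i] <;> simp_all
  rw [h1, unifProb_eq_card]
  have h2 : (Finset.univ.filter fun f : Fin w → Bool => ∀ i, N[i] = true → f i = false) =
      Fintype.piFinset fun i => if N[i] = true then {false} else Finset.univ := by
    ext f
    simp only [Finset.mem_filter, Finset.mem_univ, true_and, Fintype.mem_piFinset]
    refine forall_congr' fun i => ?_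
    split_ifs with h <;> simp [h]
  rw [h2, Fintype.card_piFinset, Fintype.card_pi]
  push_cast
  rw [← Finset.prod_div_distrib, Finset.card_filter, ← Finset.prod_pow_eq_pow_sum]
  refine Finset.prod_congr rfl fun i _ => ?_
  split_ifs <;> simp

theorem maskProb_compl_mul (N : BitVec w) : maskProb N * maskProb (~~~N) = 1 / 2 ^ w := by
  rw [maskProb_eq, maskProb_eq, ← pow_add]
  have : (Finset.univ.filter fun i : Fin w => (~~~N)[i] = true) =
      Finset.univ.filter fun i : Fin w => ¬ N[i] = true := by
    ext i; simp
  rw [this, Finset.card_filter_add_card_filter_not]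
  simp

theorem maskProb_or (N N' : BitVec w) (h : N &&& N' = 0) :
    maskProb (N ||| N') = maskProb N * maskProb N' := by
  rw [maskProb_eq, maskProb_eq, maskProb_eq, ← pow_add, ← Finset.card_union_of_disjoint]
  · congr 2
    ext i; simp
  · rw [Finset.disjoint_filter]
    intro i _ h1 h2
    have := congrArg (fun v : BitVec w => v[i]) h
    simp only [Fin.getElem_fin, BitVec.getElem_and, BitVec.ofNat_eq_ofNat,
      BitVec.getElem_zero] at this h1 h2
    simp [h1, h2] at this

end Mask

/-! ### Feistel rounds on masked words -/

section Feistel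

variable {w : ℕ} {𝒯 : Type*}

/-- A round: the bits of `x` in the mask `N` are modified by a function of the other bits. -/
def feistelRound (f : BitVec w → BitVec w) (N : BitVec w) : Equiv.Perm (BitVec w) :=
  Function.Involutive.toPerm (fun x => x ^^^ (f (x &&& ~~~N) &&& N)) fun x => by
    have : (x ^^^ (f (x &&& ~~~N) &&& N)) &&& ~~~N = x &&& ~~~N := by
      ext i hi; simp only [BitVec.getElem_and, BitVec.getElem_xor, BitVec.getElem_not]; grind
    simp only [this]
    rw [BitVec.xor_assoc, BitVec.xor_self, BitVec.xor_zero]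

theorem feistelRound_apply (f : BitVec w → BitVec w) (N x : BitVec w) :
    feistelRound f N x = x ^^^ (f (x &&& ~~~N) &&& N) := rfl

/-- The composition of five rounds, modifying in turn `A`, the complement of `A`, `A`, `B`, `C`. -/
def fiveRounds (f : Fin 5 → BitVec w → BitVec w) (A B C : BitVec w) : Equiv.Perm (BitVec w) :=
  (feistelRound (f 0) A).trans <| (feistelRound (f 1) (~~~A)).trans <|
    (feistelRound (f 2) A).trans <| (feistelRound (f 3) B).trans (feistelRound (f 4) C)

/-- The family of functions `h T` is `k`-wise independent and uniform: its values at up to `k`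
distinct points are distributed like independent uniform words. -/
def KWiseUniform [Fintype 𝒯] (k : ℕ) (h : 𝒯 → BitVec w → BitVec w) : Prop :=
  ∀ m ≤ k, ∀ x : Fin m → BitVec w, Function.Injective x → ∀ p : (Fin m → BitVec w) → Prop,
    unifProb (fun T => p fun i => h T (x i)) = unifProb p

variable [Fintype 𝒯] {k : ℕ} {h : 𝒯 → BitVec w → BitVec w}

theorem KWiseUniform.prescribed (hh : KWiseUniform k h) (x : Fin k → BitVec w)
    (hx : Function.Injective x) (z : Fin k → BitVec w) (N : BitVec w) :
    unifProb (fun T => ∀ i, h T (x i) &&& N = z i &&& N) = maskProb N ^ k := by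
  rw [hh k le_rfl x hx fun u => ∀ i, u i &&& N = z i &&& N,
    ← unifProb_comp_equiv (Equiv.piCongrRight fun i => xorEquiv (z i))]
  have := unifProb_pi_forall (ι := Fin k) fun u : BitVec w => u &&& N = 0
  rw [Fintype.card_fin] at this
  rw [maskProb, ← this]
  refine unifProb_congr fun u => forall_congr' fun i => ?_
  rw [← xor_and_eq_zero_iff]
  simp

theorem KWiseUniform.collision (hh : KWiseUniform k h) (hk : 2 ≤ k) {x y : BitVec w} (hxy : x ≠ y)
    (c N : BitVec w) :
    unifProb (fun T => (h T x ^^^ h T y) &&& N = c &&& N) ≤ maskProb N := by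
  have h1 := hh 2 hk ![x, y] (by
    intro i j hij
    fin_cases i <;> fin_cases j <;> simp_all [eq_comm]) fun u => (u 0 ^^^ u 1) &&& N = c &&& N
  simp only [Matrix.cons_val_zero, Matrix.cons_val_one] at h1
  rw [h1, ← unifProb_comp_equiv (finTwoArrowEquiv (BitVec w)).symm]
  refine unifProb_prod_le _ (maskProb_nonneg N) fun u => ?_
  rw [← unifProb_and_eq (c ^^^ u)]
  refine unifProb_mono fun v hv => ?_
  change (u ^^^ v) &&& N = c &&& N at hv
  rw [← xor_and_eq_zero_iff] at hv ⊢
  rw [← hv]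
  congr 1
  ext i hi; simp only [BitVec.getElem_xor]; grind

/-- After a round modifying `N`, two different words agree on `N' ≤ N` rarely, unless the round
function is applied to the same input in both. -/
theorem KWiseUniform.round_collision (hh : KWiseUniform k h) (hk : 2 ≤ k) {x y : BitVec w}
    (N N' : BitVec w) (hN : N' &&& N = N') (hxy : x &&& ~~~N ≠ y &&& ~~~N) :
    unifProb (fun T => feistelRound (h T) N x &&& N' = feistelRound (h T) N y &&& N') ≤
      maskProb N' := by
  refine le_trans (unifProb_mono fun T hT => ?_) (hh.collision hk hxy (x ^^^ y) N')
  rw [feistelRound_apply, feistelRound_apply] at hT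
  generalize h T (x &&& ~~~N) = u at *
  generalize h T (y &&& ~~~N) = v at *
  rw [← xor_and_eq_zero_iff] at hT ⊢
  rw [← hT]
  ext i hi
  have := congrArg (fun v : BitVec w => v[i]) hN
  simp only [BitVec.getElem_and, BitVec.getElem_xor] at this ⊢
  grind

theorem eq_of_and_eq {x y N : BitVec w} (h1 : x &&& N = y &&& N) (h2 : x &&& ~~~N = y &&& ~~~N) :
    x = y := by
  ext i hi
  have h1 := congrArg (fun v : BitVec w => v[i]) h1
  have h2 := congrArg (fun v : BitVec w => v[i]) h2
  simp only [BitVec.getElem_and, BitVec.getElem_not] at h1 h2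
  grind

theorem feistelRound_and_compl (f : BitVec w → BitVec w) (N x : BitVec w) :
    feistelRound f N x &&& ~~~N = x &&& ~~~N := by
  rw [feistelRound_apply]
  ext i hi; simp only [BitVec.getElem_and, BitVec.getElem_xor, BitVec.getElem_not]; grind

/-- The first two rounds. -/
def prepRounds (h : 𝒯 → BitVec w → BitVec w) (A : BitVec w) (T : 𝒯 × 𝒯) : Equiv.Perm (BitVec w) :=
  (feistelRound (h T.1) A).trans (feistelRound (h T.2) (~~~A))

theorem KWiseUniform.first_collision (hh : KWiseUniform k h) (hk : 2 ≤ k) {x y : BitVec w}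
    (hxy : x ≠ y) (A : BitVec w) :
    unifProb (fun T => feistelRound (h T) A x &&& A = feistelRound (h T) A y &&& A) ≤
      maskProb A := by
  by_cases hA : x &&& ~~~A = y &&& ~~~A
  · rw [unifProb_of_forall_not]
    · exact maskProb_nonneg _
    · intro T hT
      refine hxy ((feistelRound (h T) A).injective (eq_of_and_eq hT ?_))
      rw [feistelRound_and_compl, feistelRound_and_compl, hA]
  · exact hh.round_collision hk A A (by simp) hA

theorem KWiseUniform.prep_collision_compl (hh : KWiseUniform k h) (hk : 2 ≤ k) {x y : BitVec w}
    (hxy : x ≠ y) (A : BitVec w) :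
    unifProb (fun T => prepRounds h A T x &&& ~~~A = prepRounds h A T y &&& ~~~A) ≤
      maskProb (~~~A) := by
  refine unifProb_prod_le _ (maskProb_nonneg _) fun T => ?_
  have hne : feistelRound (h T) A x ≠ feistelRound (h T) A y :=
    fun e => hxy ((feistelRound (h T) A).injective e)
  exact hh.first_collision hk hne (~~~A)

theorem KWiseUniform.prep_collision [Nonempty 𝒯] (hh : KWiseUniform k h) (hk : 2 ≤ k)
    {x y : BitVec w} (hxy : x ≠ y) (A C : BitVec w) (hAC : A &&& C = 0) :
    unifProb (fun T => prepRounds h A T x &&& C = prepRounds h A T y &&& C) ≤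
      maskProb A + maskProb C := by
  have hsplit := unifProb_or_le
    (fun T : 𝒯 × 𝒯 => feistelRound (h T.1) A x &&& A = feistelRound (h T.1) A y &&& A)
    (fun T : 𝒯 × 𝒯 => feistelRound (h T.1) A x &&& A ≠ feistelRound (h T.1) A y &&& A ∧
      prepRounds h A T x &&& C = prepRounds h A T y &&& C)
  refine le_trans (unifProb_mono fun T hT => ?_) (hsplit.trans (add_le_add ?_ ?_))
  · by_cases h : feistelRound (h T.1) A x &&& A = feistelRound (h T.1) A y &&& A
    · exact Or.inl h
    · exact Or.inr ⟨h, hT⟩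
  · rw [unifProb_prod_fst
      (fun T => feistelRound (h T) A x &&& A = feistelRound (h T) A y &&& A)]
    exact hh.first_collision hk hxy A
  · refine unifProb_prod_le _ (maskProb_nonneg _) fun T => ?_
    by_cases hA : feistelRound (h T) A x &&& A = feistelRound (h T) A y &&& A
    · rw [unifProb_of_forall_not]
      · exact maskProb_nonneg _
      · exact fun _ h => h.1 hA
    · refine le_trans (unifProb_mono fun T' hT' => hT'.2)
        (hh.round_collision hk (x := feistelRound (h T) A x) (y := feistelRound (h T) A y)
          (~~~A) C ?_ (by simpa using hA))
      ext i hi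
      have := congrArg (fun v : BitVec w => v[i]) hAC
      simp only [BitVec.getElem_and, BitVec.getElem_not, BitVec.ofNat_eq_ofNat,
        BitVec.getElem_zero] at this ⊢
      grind

end Feistel

section Feistel

variable {w : ℕ} {𝒯 : Type*} [Fintype 𝒯] {k : ℕ} {h : 𝒯 → BitVec w → BitVec w}

/-- If the first two rounds have led to the words `z i` and the last three lead to the words `b i`,
then the round functions of the latter are applied to the bits of `z i` outside `A`, to the bits of
`b i` in `A` together with those of `z i` in `C`, and to the bits of `b i` outside `C`. This is the
event that, for one of these functions, the inputs for two of the words agree. -/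
def HasCollision (A C : BitVec w) (z b : Fin k → BitVec w) : Prop :=
  ∃ ij ∈ (Finset.univ : Finset (Fin k)).offDiag,
    z ij.1 &&& ~~~A = z ij.2 &&& ~~~A ∨
    (b ij.1 &&& A = b ij.2 &&& A ∧ z ij.1 &&& C = z ij.2 &&& C) ∨
    b ij.1 &&& ~~~C = b ij.2 &&& ~~~C

/-- The word that agrees with `b` on the mask `A` and with `z` elsewhere. -/
def blend (A z b : BitVec w) : BitVec w := z ^^^ ((z ^^^ b) &&& A)

/-- Three masks partition the bits of a word. -/
structure IsMaskPartition (A B C : BitVec w) : Prop where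
  disj : A &&& B = 0
  disj' : A &&& C = 0
  disj'' : B &&& C = 0
  cover : A ||| B ||| C = BitVec.allOnes w

theorem IsMaskPartition.blend_blend {A B C : BitVec w} (hP : IsMaskPartition A B C)
    (z b : BitVec w) : blend C (blend B (blend A z b) b) b = b := by
  obtain ⟨h1, h2, h3, h4⟩ := hP
  unfold blend
  ext i hi
  have h1 := congrArg (fun v : BitVec w => v[i]) h1
  have h2 := congrArg (fun v : BitVec w => v[i]) h2
  have h3 := congrArg (fun v : BitVec w => v[i]) h3
  have h4 := congrArg (fun v : BitVec w => v[i]) h4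
  simp only [BitVec.getElem_and, BitVec.getElem_xor, BitVec.getElem_or, BitVec.getElem_allOnes,
    BitVec.ofNat_eq_ofNat, BitVec.getElem_zero] at h1 h2 h3 h4 ⊢
  cases hA : A[i] <;> cases hB : B[i] <;> cases hC : C[i] <;> simp_all

theorem IsMaskPartition.maskProb_mul {A B C : BitVec w} (hP : IsMaskPartition A B C) :
    maskProb A * maskProb B * maskProb C = 1 / 2 ^ w := by
  rw [← maskProb_or A B hP.disj, mul_comm, ← maskProb_compl_mul C]
  congr 2
  obtain ⟨h1, h2, h3, h4⟩ := hP
  ext i hi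
  have h1 := congrArg (fun v : BitVec w => v[i]) h1
  have h2 := congrArg (fun v : BitVec w => v[i]) h2
  have h3 := congrArg (fun v : BitVec w => v[i]) h3
  have h4 := congrArg (fun v : BitVec w => v[i]) h4
  simp only [BitVec.getElem_and, BitVec.getElem_not, BitVec.getElem_or, BitVec.getElem_allOnes,
    BitVec.ofNat_eq_ofNat, BitVec.getElem_zero] at h1 h2 h3 h4 ⊢
  cases hA : A[i] <;> cases hB : B[i] <;> cases hC : C[i] <;> simp_all

theorem feistelRound_eq_blend {f : BitVec w → BitVec w} {N x y z b : BitVec w}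
    (hy : x &&& ~~~N = y) (hf : f y &&& N = (z ^^^ b) &&& N) (hx : x = z) :
    feistelRound f N x = blend N z b := by
  rw [feistelRound_apply, hy, hf, hx]
  rfl

/-- Without collisions, the last three rounds map the words `z i` to the words `b i` with the
probability `2 ^ (-w * k)` of given independent uniform words: the bits in `A`, `B` and `C` of the
images are determined by the third, fourth and fifth round function, each at `k` distinct
points. -/
theorem KWiseUniform.lastRounds (hh : KWiseUniform k h) {A B C : BitVec w}
    (hP : IsMaskPartition A B C) (z b : Fin k → BitVec w) (hzb : ¬ HasCollision A C z b) :
    (((2 : ℝ) ^ w) ^ k)⁻¹ ≤ unifProb fun T : 𝒯 × 𝒯 × 𝒯 =>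
      (fun i => feistelRound (h T.2.2) C (feistelRound (h T.2.1) B
        (feistelRound (h T.1) A (z i)))) = b := by
  have hzb' : ∀ i j, i ≠ j → ¬ (z i &&& ~~~A = z j &&& ~~~A) ∧
      ¬ (b i &&& A = b j &&& A ∧ z i &&& C = z j &&& C) ∧
      ¬ (b i &&& ~~~C = b j &&& ~~~C) := by
    intro i j hij
    refine ⟨fun e => hzb ⟨(i, j), by simpa using hij, Or.inl e⟩,
      fun e => hzb ⟨(i, j), by simpa using hij, Or.inr (Or.inl e)⟩,
      fun e => hzb ⟨(i, j), by simpa using hij, Or.inr (Or.inr e)⟩⟩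
  have hinj1 : Function.Injective fun i => z i &&& ~~~A := by
    intro i j hij
    by_contra hne
    exact (hzb' i j hne).1 hij
  have hinj2 : Function.Injective fun i => blend A (z i) (b i) &&& ~~~B := by
    intro i j hij
    by_contra hne
    refine (hzb' i j hne).2.1 ⟨?_, ?_⟩
    all_goals
      obtain ⟨h1, h2, h3, h4⟩ := hP
      ext l hl
      have h1 := congrArg (fun v : BitVec w => v[l]) h1
      have h2 := congrArg (fun v : BitVec w => v[l]) h2
      have h3 := congrArg (fun v : BitVec w => v[l]) h3
      have h5 := congrArg (fun v : BitVec w => v[l]) hij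
      simp only [blend, BitVec.getElem_and, BitVec.getElem_not, BitVec.getElem_xor,
        BitVec.ofNat_eq_ofNat, BitVec.getElem_zero] at h1 h2 h3 h5 ⊢
      cases hA : A[l] <;> cases hB : B[l] <;> cases hC : C[l] <;> simp_all
  have hinj3 : Function.Injective fun i => b i &&& ~~~C := by
    intro i j hij
    by_contra hne
    exact (hzb' i j hne).2.2 hij
  have e1 := hh.prescribed _ hinj1 (fun i => z i ^^^ b i) A
  have e2 := hh.prescribed _ hinj2 (fun i => blend A (z i) (b i) ^^^ b i) B
  have e3 := hh.prescribed _ hinj3 (fun i => blend B (blend A (z i) (b i)) (b i) ^^^ b i) C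
  have hprod := unifProb_prod_and
    (fun T => ∀ i, h T (z i &&& ~~~A) &&& A = (z i ^^^ b i) &&& A)
    (fun T : 𝒯 × 𝒯 =>
      (∀ i, h T.1 (blend A (z i) (b i) &&& ~~~B) &&& B = (blend A (z i) (b i) ^^^ b i) &&& B) ∧
      (∀ i, h T.2 (b i &&& ~~~C) &&& C = (blend B (blend A (z i) (b i)) (b i) ^^^ b i) &&& C))
  rw [e1, unifProb_prod_and
    (fun T => ∀ i, h T (blend A (z i) (b i) &&& ~~~B) &&& B = (blend A (z i) (b i) ^^^ b i) &&& B)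
    (fun T => ∀ i, h T (b i &&& ~~~C) &&& C =
      (blend B (blend A (z i) (b i)) (b i) ^^^ b i) &&& C), e2, e3, ← mul_assoc, ← mul_pow,
    ← mul_pow, hP.maskProb_mul, one_div, inv_pow] at hprod
  rw [← hprod]
  refine unifProb_mono fun T hT => funext fun i => ?_
  obtain ⟨hT1, hT2, hT3⟩ := hT
  have hb := hP.blend_blend (z i) (b i)
  refine (feistelRound_eq_blend ?_ (hT3 i) ?_).trans hb
  swap
  · refine feistelRound_eq_blend ?_ (hT2 i) ?_
    swap
    · exact feistelRound_eq_blend rfl (hT1 i) rfl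
    · rw [feistelRound_eq_blend rfl (hT1 i) rfl]
  · rw [feistelRound_eq_blend (by rw [feistelRound_eq_blend rfl (hT1 i) rfl]) (hT2 i)
      (feistelRound_eq_blend rfl (hT1 i) rfl)]
    conv_rhs => rw [← hb]
    generalize blend B (blend A (z i) (b i)) (b i) = u
    unfold blend
    ext l hl
    simp only [BitVec.getElem_and, BitVec.getElem_not, BitVec.getElem_xor]
    cases C[l] <;> simp

/-- For the images `b` of distinct words under a random permutation, collisions are rare. -/
theorem KWiseUniform.collision_le [Nonempty 𝒯] (hh : KWiseUniform k h) {A C : BitVec w}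
    (hAC : A &&& C = 0) {x : Fin k → BitVec w} (hx : Function.Injective x) :
    unifProb (fun σT : Equiv.Perm (BitVec w) × (𝒯 × 𝒯) =>
      HasCollision A C (fun i => prepRounds h A σT.2 (x i)) (fun i => σT.1 (x i))) ≤
    (k : ℝ) ^ 2 * (maskProb (~~~A) + maskProb A * (maskProb A + maskProb C) +
      maskProb (~~~C)) := by
  have hperm : ∀ N u v : BitVec w, u ≠ v →
      unifProb (fun σ : Equiv.Perm (BitVec w) => σ u &&& N = σ v &&& N) ≤ maskProb N := by
    intro N u v huv
    have hF : maskProb N = ((Finset.univ.filter fun u : BitVec w => u &&& N = 0).card : ℝ) /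
        Fintype.card (BitVec w) := unifProb_eq_card _
    rw [hF]
    refine unifProb_perm_collision_mul_le (fun u => u &&& N) _ (fun u => ?_)
      (Finset.card_le_univ _) huv
    rw [← hF, unifProb_and_eq]
  -- union bound over the ordered pairs of words; a factor of two is given away here
  refine (unifProb_exists_mem_le _ _).trans ?_
  have hbound : ∀ ij ∈ (Finset.univ : Finset (Fin k)).offDiag,
      unifProb (fun σT : Equiv.Perm (BitVec w) × (𝒯 × 𝒯) =>
        prepRounds h A σT.2 (x ij.1) &&& ~~~A = prepRounds h A σT.2 (x ij.2) &&& ~~~A ∨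
        (σT.1 (x ij.1) &&& A = σT.1 (x ij.2) &&& A ∧
          prepRounds h A σT.2 (x ij.1) &&& C = prepRounds h A σT.2 (x ij.2) &&& C) ∨
        σT.1 (x ij.1) &&& ~~~C = σT.1 (x ij.2) &&& ~~~C) ≤
      maskProb (~~~A) + maskProb A * (maskProb A + maskProb C) + maskProb (~~~C) := by
    intro ij hij
    have hne : ij.1 ≠ ij.2 := by simpa using hij
    have hk : 2 ≤ k := by
      have h1 := ij.1.isLt
      have h2 := ij.2.isLt
      have := Fin.val_ne_of_ne hne
      omega
    have hxy : x ij.1 ≠ x ij.2 := fun e => hne (hx e)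
    rw [add_assoc]
    refine (unifProb_or_le _ _).trans (add_le_add ?_ ((unifProb_or_le _ _).trans
      (add_le_add ?_ ?_)))
    · rw [unifProb_prod_snd (fun T : 𝒯 × 𝒯 =>
        prepRounds h A T (x ij.1) &&& ~~~A = prepRounds h A T (x ij.2) &&& ~~~A)]
      exact hh.prep_collision_compl hk hxy A
    · rw [unifProb_prod_and (fun σ : Equiv.Perm (BitVec w) => σ (x ij.1) &&& A = σ (x ij.2) &&& A)
        (fun T : 𝒯 × 𝒯 => prepRounds h A T (x ij.1) &&& C = prepRounds h A T (x ij.2) &&& C)]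
      exact mul_le_mul (hperm A _ _ hxy) (hh.prep_collision hk hxy A C hAC)
        (unifProb_nonneg _) (maskProb_nonneg _)
    · rw [unifProb_prod_fst
        (fun σ : Equiv.Perm (BitVec w) => σ (x ij.1) &&& ~~~C = σ (x ij.2) &&& ~~~C)]
      exact hperm _ _ _ hxy
  refine (Finset.sum_le_sum hbound).trans ?_
  rw [Finset.sum_const, nsmul_eq_mul]
  have hA := maskProb_nonneg A
  have hA' := maskProb_nonneg (~~~A)
  have hC := maskProb_nonneg C
  have hC' := maskProb_nonneg (~~~C)
  refine mul_le_mul_of_nonneg_right ?_ (by positivity)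
  rw [Finset.offDiag_card, Finset.card_univ, Fintype.card_fin, sq]
  exact_mod_cast Nat.sub_le _ _

/-- The keys of the five rounds, the first two and the last three grouped together. -/
def fiveKeysEquiv (𝒯 : Type*) : (𝒯 × 𝒯) × (𝒯 × 𝒯 × 𝒯) ≃ (Fin 5 → 𝒯) where
  toFun T := ![T.1.1, T.1.2, T.2.1, T.2.2.1, T.2.2.2]
  invFun T := ((T 0, T 1), (T 2, T 3, T 4))
  left_inv T := rfl
  right_inv T := by ext i; fin_cases i <;> rfl

theorem fiveRounds_fiveKeysEquiv {𝒰 : Type*} (h : 𝒰 → BitVec w → BitVec w) (A B C : BitVec w)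
    (T : 𝒰 × 𝒰) (T' : 𝒰 × 𝒰 × 𝒰) (x : BitVec w) :
    fiveRounds (fun r => h (fiveKeysEquiv 𝒰 (T, T') r)) A B C x =
      feistelRound (h T'.2.2) C (feistelRound (h T'.2.1) B
        (feistelRound (h T'.1) A (prepRounds h A T x))) := rfl

/-- Five rounds with `k`-wise independent round functions give a `k`-wise almost independent
family of permutations. -/
theorem KWiseUniform.kWiseDependent_fiveRounds [Nonempty 𝒯] (hh : KWiseUniform k h)
    {A B C : BitVec w} (hP : IsMaskPartition A B C) {δ : ℝ}
    (hδ : (k : ℝ) ^ 2 * (maskProb (~~~A) + maskProb A * (maskProb A + maskProb C) +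
      maskProb (~~~C)) + (k : ℝ) ^ 2 / 2 ^ w ≤ δ) :
    KWiseDependent k δ fun T : Fin 5 → 𝒯 => fiveRounds (fun r => h (T r)) A B C := by
  intro x hx
  set bad : (Fin k → BitVec w) → ℝ := fun b => unifProb fun T : 𝒯 × 𝒯 =>
    HasCollision A C (fun i => prepRounds h A T (x i)) b with hbad
  have hcard : (Fintype.card (BitVec w) : ℝ) = 2 ^ w := by rw [card_bitVec]; norm_cast
  refine (statDist_le_average _ _ (fun b => (k : ℝ) ^ 2 / 2 ^ w + bad b)
    (fun b => add_nonneg (by positivity) (unifProb_nonneg _)) fun σ => ?_).trans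
      (le_trans ?_ hδ)
  -- the pointwise bound holds with the defect `k ^ 2 / 2 ^ w + bad b`
  · set b : Fin k → BitVec w := fun i => σ (x i) with hb
    have hbinj : Function.Injective b := σ.injective.comp hx
    have hq := unifProb_perm_tuple_mul_le hx hbinj Fintype.card_pos
    rw [hcard] at hq
    rw [← unifProb_comp_equiv (fiveKeysEquiv 𝒯)
      fun T => (fun i => fiveRounds (fun r => h (T r)) A B C (x i)) = b]
    have hlast := unifProb_mul_le_prod
      (fun T : 𝒯 × 𝒯 => ¬ HasCollision A C (fun i => prepRounds h A T (x i)) b)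
      (fun T : (𝒯 × 𝒯) × (𝒯 × 𝒯 × 𝒯) => (fun i =>
        fiveRounds (fun r => h (fiveKeysEquiv 𝒯 T r)) A B C (x i)) = b)
      (fun T hT => by
        simp only [fiveRounds_fiveKeysEquiv]
        exact hh.lastRounds hP (fun i => prepRounds h A T (x i)) b hT)
    refine le_trans ?_ hlast
    have hnot := unifProb_add_not
      (fun T : 𝒯 × 𝒯 => HasCollision A C (fun i => prepRounds h A T (x i)) b)
    have hbad0 : 0 ≤ bad b := unifProb_nonneg _
    have hbad1 : bad b ≤ 1 := unifProb_le_one _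
    have hnot' : unifProb
        (fun T : 𝒯 × 𝒯 => ¬ HasCollision A C (fun i => prepRounds h A T (x i)) b) =
        1 - bad b := by
      rw [hbad]; linarith
    rw [hnot']
    set Q := unifProb fun ω : Equiv.Perm (BitVec w) => (fun i => ω (x i)) = b
    have hQ : 0 ≤ Q := unifProb_nonneg _
    have h1 : (1 - bad b) * (Q * (1 - (k : ℝ) ^ 2 / 2 ^ w)) ≤
        (1 - bad b) * (((2 : ℝ) ^ w) ^ k)⁻¹ := mul_le_mul_of_nonneg_left hq (by linarith)
    refine le_trans ?_ h1
    have h2 : 0 ≤ Q * (bad b * ((k : ℝ) ^ 2 / 2 ^ w)) := by positivity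
    nlinarith
  · have hcol := hh.collision_le hP.disj' hx
    rw [unifProb_prod] at hcol
    rw [Finset.sum_add_distrib, add_div, add_comm]
    refine add_le_add hcol ?_
    rw [Finset.sum_const, nsmul_eq_mul, Finset.card_univ, mul_div_cancel_left₀]
    exact_mod_cast Fintype.card_ne_zero

theorem KWiseDependent.of_one_le {K D : Type*} [Fintype K] [Nonempty K] [Fintype D]
    [DecidableEq D] {δ : ℝ} (hδ : 1 ≤ δ) (π : K → Equiv.Perm D) : KWiseDependent k δ π :=
  fun _ _ => (statDist_le_one _ _).trans hδ

theorem KWiseDependent.comp_equiv {K K' D : Type*} [Fintype K] [Fintype K'] [Fintype D]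
    [DecidableEq D] {δ : ℝ} {π : K' → Equiv.Perm D} (hπ : KWiseDependent k δ π) (e : K ≃ K') :
    KWiseDependent k δ fun s => π (e s) := by
  intro x hx
  refine le_trans (le_of_eq ?_) (hπ x hx)
  unfold statDist
  congr 1
  refine Finset.sum_congr rfl fun b _ => ?_
  rw [← unifProb_comp_equiv e fun s => (fun i => π s (x i)) = b]

end Feistel

/-! ### Unique neighbours and independence of hash functions -/

section UniqueNeighbors

variable {ι κ α β R : Type*}

/-- In the bipartite graph that joins `a` to the vertices `(j, Γ j a)`, every nonempty set of at
most `k` left vertices has a neighbour that is joined to one of them only. -/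
def HasUniqueNeighbors (k : ℕ) (Γ : κ → α → β) : Prop :=
  ∀ S : Finset α, S.Nonempty → S.card ≤ k → ∃ j, ∃ a ∈ S, ∀ a' ∈ S, Γ j a' = Γ j a → a' = a

/-- Unique neighbours pass on to powers of the graph: a unique neighbour of the set of first
coordinates is combined with one of the fibre above it, and so on. -/
theorem HasUniqueNeighbors.pi [Fintype ι] [Nonempty κ] {k : ℕ} {Γ : κ → α → β}
    (hΓ : HasUniqueNeighbors k Γ) :
    HasUniqueNeighbors k fun (J : ι → κ) (y : ι → α) (i : ι) => Γ (J i) (y i) := by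
  classical
  have key : ∀ s : Finset ι, ∀ S : Finset (ι → α), S.Nonempty → S.card ≤ k →
      ∃ J : ι → κ, ∃ y ∈ S, ∀ y' ∈ S, (∀ i ∈ s, Γ (J i) (y' i) = Γ (J i) (y i)) →
        ∀ i ∈ s, y' i = y i := by
    intro s
    induction s using Finset.induction_on with
    | empty =>
      rintro S ⟨y, hy⟩ hk
      exact ⟨fun _ => Classical.arbitrary κ, y, hy, by simp⟩
    | insert i₀ s hi ih =>
      intro S hS hk
      obtain ⟨j, a, ha, haj⟩ := hΓ (S.image fun y => y i₀) (hS.image _)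
        (Finset.card_image_le.trans hk)
      obtain ⟨y₀, hy₀, rfl⟩ := Finset.mem_image.1 ha
      obtain ⟨J, y, hy, hJ⟩ := ih (S.filter fun y => y i₀ = y₀ i₀)
        ⟨y₀, Finset.mem_filter.2 ⟨hy₀, rfl⟩⟩ ((Finset.card_filter_le _ _).trans hk)
      obtain ⟨hyS, hyi⟩ := Finset.mem_filter.1 hy
      refine ⟨Function.update J i₀ j, y, hyS, fun y' hy' h => ?_⟩
      have h0 : y' i₀ = y i₀ := by
        have := h i₀ (Finset.mem_insert_self _ _)
        rw [Function.update_self, hyi] at this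
        rw [hyi]
        exact haj _ (Finset.mem_image_of_mem _ hy') this
      have hs : ∀ i ∈ s, y' i = y i := by
        refine hJ y' (Finset.mem_filter.2 ⟨hy', h0.trans hyi⟩) fun i his => ?_
        have := h i (Finset.mem_insert_of_mem his)
        rwa [Function.update_of_ne (by rintro rfl; exact hi his)] at this
      intro i hmem
      rcases Finset.mem_insert.1 hmem with rfl | his
      · exact h0
      · exact hs i his
  intro S hS hk
  obtain ⟨J, y, hy, hJ⟩ := key Finset.univ S hS hk
  exact ⟨J, y, hy, fun y' hy' h => funext fun i => hJ y' hy' (fun i _ => congrFun h i) i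
    (Finset.mem_univ i)⟩

variable [Fintype κ] [AddCommGroup R]

/-- The hash function given by the table `T` of words at the right vertices of a graph: the sum of
the words at the neighbours. -/
def tableHash (Γ : κ → α → β) : (κ × β → R) →+ (α → R) where
  toFun T a := ∑ j, T (j, Γ j a)
  map_zero' := by ext; simp
  map_add' T T' := by ext; simp [Finset.sum_add_distrib]

theorem tableHash_apply (Γ : κ → α → β) (T : κ × β → R) (a : α) :
    tableHash Γ T a = ∑ j, T (j, Γ j a) := rfl

/-- The values at up to `k` points can be prescribed: changing the table at a unique neighbour
changes the value at one point only. -/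
theorem HasUniqueNeighbors.exists_tableHash_eq {k : ℕ} {Γ : κ → α → β}
    (hΓ : HasUniqueNeighbors k Γ) (z : α → R) (S : Finset α) (hS : S.card ≤ k) :
    ∃ T : κ × β → R, ∀ a ∈ S, tableHash Γ T a = z a := by
  classical
  induction hs : S.card generalizing S with
  | zero => exact ⟨0, by simp [Finset.card_eq_zero.1 hs]⟩
  | succ s ih =>
    obtain ⟨j, a, ha, hja⟩ := hΓ S (Finset.card_pos.1 (by omega)) hS
    have hcard := Finset.card_erase_of_mem ha
    obtain ⟨T, hT⟩ := ih (S.erase a) (by omega) (by omega)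
    have hsingle : ∀ v : R, ∀ a' ∈ S, tableHash Γ (Pi.single (j, Γ j a) v) a' =
        if a' = a then v else 0 := by
      intro v a' ha'
      rw [tableHash_apply, Finset.sum_eq_single j]
      · by_cases h : a' = a
        · rw [if_pos h, h, Pi.single_eq_same]
        · rw [if_neg h, Pi.single_eq_of_ne]
          exact fun e => h (hja a' ha' (congrArg Prod.snd e))
      · intro j' _ hj'
        rw [Pi.single_eq_of_ne]
        exact fun e => hj' (congrArg Prod.fst e)
      · simp
    refine ⟨T + Pi.single (j, Γ j a) (z a - tableHash Γ T a), fun a' ha' => ?_⟩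
    rw [map_add, Pi.add_apply, hsingle _ a' ha']
    split_ifs with h
    · rw [h, add_sub_cancel]
    · rw [add_zero, hT a' (Finset.mem_erase.2 ⟨h, ha'⟩)]

/-- Truncation of words, as a homomorphism. -/
def truncHom {g W : ℕ} (h : g ≤ W) : BitVec W →+ BitVec g where
  toFun u := u.setWidth g
  map_zero' := by simp
  map_add' x y := BitVec.setWidth_add x y h

/-- Hash functions with unique neighbours, with values truncated to `w` bits, are `k`-wise
independent. -/
theorem HasUniqueNeighbors.kWiseUniform [Fintype β] [DecidableEq κ] [DecidableEq β] {k w W : ℕ}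
    {Γ : κ → α → β} (hΓ : HasUniqueNeighbors k Γ) (hw : w ≤ W) (e : BitVec w → α)
    (he : Function.Injective e) :
    KWiseUniform k fun (T : κ × β → BitVec W) (u : BitVec w) =>
      (tableHash Γ T (e u)).setWidth w := by
  classical
  intro m hm x hx p
  let φ : (κ × β → BitVec W) →+ (Fin m → BitVec w) :=
    AddMonoidHom.mk' (fun T i => truncHom hw (tableHash Γ T (e (x i)))) fun T T' => by
      ext1 i
      rw [map_add, Pi.add_apply, map_add]
      rfl
  refine unifProb_comp_surjective φ (fun z => ?_) p
  have hex : Function.Injective fun i => e (x i) := he.comp hx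
  obtain ⟨T, hT⟩ := hΓ.exists_tableHash_eq
    (Function.extend (fun i => e (x i)) (fun i => (z i).setWidth W) 0)
    (Finset.univ.image fun i => e (x i)) (Finset.card_image_le.trans (by simpa using hm))
  refine ⟨T, funext fun i => ?_⟩
  change (tableHash Γ T (e (x i))).setWidth w = z i
  rw [hT _ (Finset.mem_image_of_mem _ (Finset.mem_univ i)), hex.extend_apply,
    BitVec.setWidth_setWidth_of_le _ hw, BitVec.setWidth_eq]

end UniqueNeighbors

/-! ### Random graphs have unique neighbours -/

section RandomGraph

/-- A bound for the square of the probability that a random map on a set of size `s` has no fibre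
of size one. A map from a set of size `s` without fibres of size one has at most `s / 2` values, and hence
factors through a set of size `s / 2`. -/
theorem unifProb_forall_exists_ne_le {A β : Type*} [Fintype A] [DecidableEq A] [Fintype β]
    [Nonempty β] :
    unifProb (fun f : A → β => ∀ a, ∃ a', f a' = f a ∧ a' ≠ a) ^ 2 ≤
      ((Fintype.card A : ℝ) ^ 2 / Fintype.card β) ^ Fintype.card A := by
  classical
  set s := Fintype.card A with hs
  set b := Fintype.card β with hb
  have hb1 : (1 : ℝ) ≤ b := by exact_mod_cast Fintype.card_pos
  have hcount : (Finset.univ.filter fun f : A → β => ∀ a, ∃ a', f a' = f a ∧ a' ≠ a).card ≤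
      b ^ (s / 2) * (s / 2) ^ s := by
    have hsub : (Finset.univ.filter fun f : A → β => ∀ a, ∃ a', f a' = f a ∧ a' ≠ a) ⊆
        Finset.univ.image fun gr : (Fin (s / 2) → β) × (A → Fin (s / 2)) => gr.1 ∘ gr.2 := by
      intro f hf
      simp only [Finset.mem_filter, Finset.mem_univ, true_and] at hf
      have hcard : 2 * (Finset.univ.image f).card ≤ s := by
        refine (Finset.mul_card_image_le_card Finset.univ 2 fun v hv => ?_).trans_eq
          Finset.card_univ
        obtain ⟨a, -, rfl⟩ := Finset.mem_image.1 hv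
        obtain ⟨a', h1, h2⟩ := hf a
        exact Finset.one_lt_card.2 ⟨a', by simp [h1], a, by simp, h2⟩
      obtain ⟨emb⟩ := Function.Embedding.nonempty_of_card_le
        (α := (Finset.univ.image f : Finset β)) (β := Fin (s / 2))
        (by rw [Fintype.card_coe, Fintype.card_fin]; omega)
      have hmem : ∀ a, f a ∈ Finset.univ.image f :=
        fun a => Finset.mem_image_of_mem f (Finset.mem_univ a)
      refine Finset.mem_image.2 ⟨(Function.extend emb (fun v => v.1)
        (fun _ => Classical.arbitrary β), fun a => emb ⟨f a, hmem a⟩), Finset.mem_univ _, ?_⟩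
      ext1 a
      exact emb.injective.extend_apply (fun v => v.1) (fun _ => Classical.arbitrary β)
        ⟨f a, hmem a⟩
    refine (Finset.card_le_card hsub).trans (Finset.card_image_le.trans_eq ?_)
    simp [Finset.card_univ, Fintype.card_prod, ← hb, ← hs]
  rw [unifProb_eq_card, div_pow, div_pow, div_le_div_iff₀ (by positivity) (by positivity)]
  have hcard : (Fintype.card (A → β) : ℝ) = (b : ℝ) ^ s := by simp [← hb, ← hs]
  have h2 : 2 * (s / 2) ≤ s := Nat.mul_div_le s 2
  have hcount' : ((Finset.univ.filter fun f : A → β => ∀ a, ∃ a', f a' = f a ∧ a' ≠ a).card : ℝ) ≤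
      (b : ℝ) ^ (s / 2) * (s : ℝ) ^ s := by
    have h : b ^ (s / 2) * (s / 2) ^ s ≤ b ^ (s / 2) * s ^ s :=
      Nat.mul_le_mul_left _ (Nat.pow_le_pow_left (Nat.div_le_self s 2) s)
    exact_mod_cast hcount.trans h
  calc _ ≤ ((b : ℝ) ^ (s / 2) * (s : ℝ) ^ s) ^ 2 * (b : ℝ) ^ s := by gcongr
    _ = ((s : ℝ) ^ 2) ^ s * ((b : ℝ) ^ (2 * (s / 2)) * (b : ℝ) ^ s) := by ring
    _ ≤ ((s : ℝ) ^ 2) ^ s * ((b : ℝ) ^ s * (b : ℝ) ^ s) := by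
        gcongr
    _ = _ := by rw [hcard]; ring

/-- A random graph of degree `2 * d` fails to have unique neighbours with small probability; the
graph may be any homomorphic image of a uniformly random element `r`. -/
theorem unifProb_not_hasUniqueNeighbors_le {G κ α β : Type*} [AddGroup G] [Fintype G] [Fintype κ]
    [DecidableEq κ] [Fintype α] [DecidableEq α] [Fintype β] [AddGroup β] (Γ : G →+ (κ → α → β))
    (hΓ : Function.Surjective Γ) (k d : ℕ) (hd : Fintype.card κ = 2 * d) {y : ℝ}
    (hy : ((k : ℝ) ^ 2 / Fintype.card β) ^ d ≤ y) (hαy : Fintype.card α * y ≤ 1) :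
    unifProb (fun r => ¬ HasUniqueNeighbors k (Γ r)) ≤ 2 * (Fintype.card α * y) := by
  classical
  have hy0 : 0 ≤ y := le_trans (by positivity) hy
  set F : Finset (Finset α) := Finset.univ.powerset.erase ∅ with hF
  have hS : ∀ S : Finset α, S.Nonempty → S.card ≤ k →
      unifProb (fun r => ∀ j, ∀ a : S, ∃ a' : S, Γ r j a' = Γ r j a ∧ a' ≠ a) ≤ y ^ S.card := by
    intro S hS hSk
    let ψ : G →+ (κ → S → β) := AddMonoidHom.mk' (fun r j a => Γ r j a) fun r r' => by
      ext j a; simp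
    have hψ : Function.Surjective ψ := by
      intro f
      obtain ⟨r, hr⟩ := hΓ fun j => Function.extend Subtype.val (f j) 0
      refine ⟨r, funext fun j => funext fun a => ?_⟩
      change Γ r j a = f j a
      rw [hr]
      exact Subtype.val_injective.extend_apply _ _ _
    have h1 := unifProb_comp_surjective ψ hψ
      fun f => ∀ j, ∀ a : S, ∃ a' : S, f j a' = f j a ∧ a' ≠ a
    have h2 := unifProb_pi_forall (ι := κ) fun f : S → β => ∀ a, ∃ a', f a' = f a ∧ a' ≠ a
    have h3 := unifProb_forall_exists_ne_le (A := S) (β := β)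
    refine (h1.trans h2).trans_le ?_
    rw [hd, pow_mul]
    have hcard : Fintype.card S = S.card := Fintype.card_coe S
    rw [hcard] at h3
    calc _ ≤ (((S.card : ℝ) ^ 2 / Fintype.card β) ^ S.card) ^ d :=
          pow_le_pow_left₀ (by positivity) h3 d
      _ = (((S.card : ℝ) ^ 2 / Fintype.card β) ^ d) ^ S.card := by ring
      _ ≤ (((k : ℝ) ^ 2 / Fintype.card β) ^ d) ^ S.card := by gcongr
      _ ≤ y ^ S.card := by gcongr
  have hunion : unifProb (fun r => ¬ HasUniqueNeighbors k (Γ r)) ≤ ∑ S ∈ F, y ^ S.card := by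
    refine le_trans (unifProb_mono (p' := fun r => ∃ S ∈ F, S.Nonempty ∧ S.card ≤ k ∧
      ∀ j, ∀ a : S, ∃ a' : S, Γ r j a' = Γ r j a ∧ a' ≠ a) fun r hr => ?_)
      ((unifProb_exists_mem_le _ _).trans (Finset.sum_le_sum fun S _ => ?_))
    · unfold HasUniqueNeighbors at hr
      push Not at hr
      obtain ⟨S, hS, hSk, hr⟩ := hr
      refine ⟨S, by simp [hF, hS.ne_empty], hS, hSk, fun j a => ?_⟩
      obtain ⟨a', ha', h1, h2⟩ := hr j a a.2
      exact ⟨⟨a', ha'⟩, h1, fun e => h2 (congrArg Subtype.val e)⟩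
    · by_cases h : S.Nonempty ∧ S.card ≤ k
      · exact (unifProb_mono fun r hr => hr.2.2).trans (hS S h.1 h.2)
      · rw [unifProb_of_forall_not fun r hr => h ⟨hr.1, hr.2.1⟩]
        positivity
  refine hunion.trans ?_
  -- the sum over all nonempty sets is `(1 + y) ^ card α - 1`
  have hsum : ∑ S ∈ F, y ^ S.card = (1 + y) ^ Fintype.card α - 1 := by
    have h1 := Finset.prod_one_add (f := fun _ : α => y) Finset.univ
    simp only [Finset.prod_const, Finset.card_univ] at h1
    rw [h1, ← Finset.add_sum_erase _ _ (Finset.empty_mem_powerset _)]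
    simp [hF]
  rw [hsum]
  have h1 : (1 + y) ^ Fintype.card α ≤ Real.exp (Fintype.card α * y) := by
    rw [Real.exp_nat_mul]
    have := Real.add_one_le_exp y
    gcongr
    linarith
  have h0 : (0 : ℝ) ≤ Fintype.card α * y := by positivity
  have h2 := Real.abs_exp_sub_one_le (x := Fintype.card α * y) (by rwa [abs_of_nonneg h0])
  rw [abs_of_nonneg h0] at h2
  linarith [le_abs_self (Real.exp (Fintype.card α * y) - 1)]

end RandomGraph

/-! ### Straight-line programs -/

namespace WordRAM

theorem run_add {W : ℕ} (P : Program) (tape : ℕ → BitVec W) (t t' : ℕ) (s : State W) :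
    run P tape (t + t') s = run P tape t' (run P tape t s) := by
  unfold run
  rw [add_comm, Function.iterate_add_apply]

theorem run_one {W : ℕ} (P : Program) (tape : ℕ → BitVec W) (s : State W) :
    run P tape 1 s = step P tape s := rfl

theorem run_succ {W : ℕ} (P : Program) (tape : ℕ → BitVec W) (t : ℕ) (s : State W) :
    run P tape (t + 1) s = run P tape t (step P tape s) := rfl

theorem run_of_halted {W : ℕ} (P : Program) (tape : ℕ → BitVec W) (t : ℕ) (s : State W)
    (h : Halted P s) : run P tape t s = s := by
  unfold run
  refine Function.iterate_fixed ?_ t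
  unfold step
  rw [List.getElem?_eq_none h]

/-- Expressions over the input word and the memory. -/
inductive Expr
  | inp
  | const (c : ℕ)
  | op (o : Op) (e e' : Expr)
  | load (e : Expr)

namespace Expr

variable {W : ℕ}

/-- The value of an expression, for the input word `x`. -/
def eval (x : BitVec W) (mem : BitVec W → BitVec W) : Expr → BitVec W
  | inp => x
  | const c => BitVec.ofNat W c
  | op o e e' => o.apply (e.eval x mem) (e'.eval x mem)
  | load e => mem (e.eval x mem)

/-- Code that puts the value of the expression into register `r`. It leaves the registers below `r`
unchanged; register `0` holds the input word. -/
def compile : Expr → ℕ → Program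
  | inp, r => [.op .or r 0 0]
  | const c, r => [.const r c]
  | op o e e', r => e.compile r ++ (e'.compile (r + 1) ++ [.op o r r (r + 1)])
  | load e, r => e.compile r ++ [.load r r]

theorem run_compile (e : Expr) (tape : ℕ → BitVec W) (r : ℕ) (hr : 1 ≤ r) (pre post : Program)
    (s : State W) (hs : s.pc = pre.length) :
    let s' := run (pre ++ (e.compile r ++ post)) tape (e.compile r).length s
    s'.pc = pre.length + (e.compile r).length ∧ s'.mem = s.mem ∧
      s'.reg r = e.eval (s.reg 0) s.mem ∧ ∀ i < r, s'.reg i = s.reg i := by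
  induction e generalizing r pre post s with
  | inp =>
    have : (pre ++ (compile inp r ++ post))[s.pc]? = some (.op .or r 0 0) := by
      simp [hs, compile]
    simp only [compile, List.length_singleton, run_one] at this ⊢
    simp only [step, this]
    refine ⟨by simp [hs], trivial, by simp [eval, Op.apply], fun i hi => ?_⟩
    rw [Function.update_of_ne hi.ne]
  | const c =>
    have : (pre ++ (compile (const c) r ++ post))[s.pc]? = some (.const r c) := by
      simp [hs, compile]
    simp only [compile, List.length_singleton, run_one] at this ⊢
    simp only [step, this]
    refine ⟨by simp [hs], trivial, by simp [eval], fun i hi => ?_⟩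
    rw [Function.update_of_ne hi.ne]
  | op o e e' ih ih' =>
    set P := pre ++ ((op o e e').compile r ++ post) with hP
    have hP1 : P =
        pre ++ (e.compile r ++ ((e'.compile (r + 1) ++ [.op o r r (r + 1)]) ++ post)) := by
      rw [hP, compile]; simp only [List.append_assoc]
    have hP2 : P =
        (pre ++ e.compile r) ++ (e'.compile (r + 1) ++ (.op o r r (r + 1) :: post)) := by
      rw [hP, compile]; simp only [List.append_assoc, List.cons_append, List.nil_append]
    have hlen : ((op o e e').compile r).length =
        (e.compile r).length + ((e'.compile (r + 1)).length + 1) := by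
      rw [compile]; simp
    rw [hlen, run_add, run_add, run_one]
    have h1 := ih r hr pre ((e'.compile (r + 1) ++ [.op o r r (r + 1)]) ++ post) s hs
    rw [← hP1] at h1
    set s1 := run P tape (e.compile r).length s
    obtain ⟨hpc1, hmem1, hreg1, hlow1⟩ := h1
    have h2 := ih' (r + 1) (by omega) (pre ++ e.compile r) (.op o r r (r + 1) :: post) s1
      (by rw [hpc1, List.length_append])
    rw [← hP2] at h2
    set s2 := run P tape (e'.compile (r + 1)).length s1
    obtain ⟨hpc2, hmem2, hreg2, hlow2⟩ := h2
    have hget : P[s2.pc]? = some (.op o r r (r + 1)) := by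
      rw [hP2, ← List.append_assoc, hpc2, ← List.length_append, List.getElem?_append_right le_rfl]
      simp
    simp only [step, hget]
    refine ⟨?_, hmem2.trans hmem1, ?_, fun i hi => ?_⟩
    · rw [hpc2, List.length_append]; omega
    · rw [Function.update_self, hreg2, hlow2 r (by omega), hreg1, hlow1 0 (by omega), hmem1, eval]
    · rw [Function.update_of_ne hi.ne, hlow2 i (by omega), hlow1 i hi]
  | load e ih =>
    set P := pre ++ ((load e).compile r ++ post) with hP
    have hP1 : P = pre ++ (e.compile r ++ (.load r r :: post)) := by
      rw [hP, compile]; simp only [List.append_assoc, List.cons_append, List.nil_append]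
    have hlen : ((load e).compile r).length = (e.compile r).length + 1 := by
      rw [compile]; simp
    rw [hlen, run_add, run_one]
    have h1 := ih r hr pre (.load r r :: post) s hs
    rw [← hP1] at h1
    set s1 := run P tape (e.compile r).length s
    obtain ⟨hpc1, hmem1, hreg1, hlow1⟩ := h1
    have hget : P[s1.pc]? = some (.load r r) := by
      rw [hP1, ← List.append_assoc, hpc1, ← List.length_append, List.getElem?_append_right le_rfl]
      simp
    simp only [step, hget]
    refine ⟨?_, hmem1, ?_, fun i hi => ?_⟩
    · rw [hpc1]; omega
    · rw [Function.update_self, hreg1, hmem1, eval]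
    · rw [Function.update_of_ne hi.ne, hlow1 i hi]

/-- A program that replaces the word in register `0` by the value of the expression. -/
def program (e : Expr) : Program := e.compile 1 ++ [.op .or 0 1 1]

theorem run_program (e : Expr) (tape : ℕ → BitVec W) (s : State W) (hs : s.pc = 0) :
    Halted e.program (run e.program tape e.program.length s) ∧
      (run e.program tape e.program.length s).reg 0 = e.eval (s.reg 0) s.mem := by
  have h := e.run_compile tape 1 le_rfl [] [.op .or 0 1 1] s hs
  have hlen : e.program.length = (e.compile 1).length + 1 := by simp [program]
  have hprog : e.compile 1 ++ [.op .or 0 1 1] = e.program := rfl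
  rw [List.nil_append, hprog] at h
  rw [hlen, run_add, run_one]
  set s1 := run e.program tape (e.compile 1).length s
  obtain ⟨hpc, hmem, hreg, -⟩ := h
  have hget : e.program[s1.pc]? = some (.op .or 0 1 1) := by
    rw [hpc]; simp [program]
  simp only [step, hget]
  refine ⟨?_, ?_⟩
  · unfold Halted
    rw [hlen]
    change _ ≤ s1.pc + 1
    rw [hpc, List.length_nil]
    omega
  · rw [Function.update_self, Op.apply, BitVec.or_self, hreg]

/-- The sum of a list of expressions. -/
def sum (l : List Expr) : Expr := l.foldr (op .add) (const 0)

theorem eval_sum (x : BitVec W) (mem : BitVec W → BitVec W) (l : List Expr) :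
    (sum l).eval x mem = (l.map (eval x mem)).sum := by
  induction l with
  | nil => rfl
  | cons e l ih => rw [List.map_cons, List.sum_cons, ← ih]; rfl

theorem eval_sum_ofFn (x : BitVec W) (mem : BitVec W → BitVec W) {n : ℕ} (f : Fin n → Expr) :
    (sum (List.ofFn f)).eval x mem = ∑ i, (f i).eval x mem := by
  rw [eval_sum, List.map_ofFn, List.sum_ofFn]
  rfl

end Expr

end WordRAM

/-! ### The collection of permutations and its evaluator -/

namespace WordRAM

/-- Number of bits of the characters into which a word is cut; `lg` stands for `⌊log₂ n⌋`. -/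
def charBits (lg : ℕ) : ℕ := lg / 2

/-- Number of bits of the values that the character graph assigns to single characters. With
`2 ^ s` characters, the concatenated values have at most `lg / 2` bits. -/
def valBits (s lg : ℕ) : ℕ := lg / 2 ^ (s + 1)

/-- The right vertices of the power of the character graph, which are the cells of the table of
one round: tuples of `q` edge labels with tuples of `q` values. -/
abbrev Cell (d q g : ℕ) : Type := (Fin q → Fin d) × (Fin q → BitVec g)

/-- The numbering of the cells in memory. -/
def cellEquiv (d q g : ℕ) : Cell d q g ≃ Fin (d ^ q * (2 ^ g) ^ q) :=
  (Equiv.prodCongr finFunctionFinEquiv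
    ((Equiv.arrowCongr (Equiv.refl _) BitVec.equivFin.toEquiv).trans finFunctionFinEquiv)).trans
    finProdFinEquiv

theorem cellEquiv_val (d q g : ℕ) (J : Fin q → Fin d) (v : Fin q → BitVec g) :
    (cellEquiv d q g (J, v) : ℕ) =
      (∑ i, (v i).toNat * (2 ^ g) ^ (i : ℕ)) + (2 ^ g) ^ q * (finFunctionFinEquiv J : ℕ) := by
  change ((finFunctionFinEquiv fun i => (v i).toFin : Fin _) : ℕ) + _ = _
  rw [finFunctionFinEquiv_apply]
  rfl

/-- The number of words of a key: one table for each of the five rounds. -/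
abbrev keyWords (d q g : ℕ) : ℕ := 5 * (d ^ q * (2 ^ g) ^ q)

/-- The position in the key of the cells of the tables of all rounds. -/
def keyIndex (d q g : ℕ) : Fin 5 × Cell d q g ≃ Fin (keyWords d q g) :=
  (Equiv.prodCongr (Equiv.refl _) (cellEquiv d q g)).trans finProdFinEquiv

theorem keyIndex_val (d q g : ℕ) (r : Fin 5) (J : Fin q → Fin d) (v : Fin q → BitVec g) :
    (keyIndex d q g (r, (J, v)) : ℕ) =
      (r * d ^ q + (finFunctionFinEquiv J : ℕ)) * 2 ^ (g * q) +
        ∑ i, (v i).toNat * 2 ^ (g * (i : ℕ)) := by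
  change (cellEquiv d q g (J, v) : ℕ) + _ * (r : ℕ) = _
  rw [cellEquiv_val]
  simp only [pow_mul]
  ring

/-- A key as the family of the tables of the five rounds. -/
def keyEquiv (d q g W : ℕ) :
    (Fin (keyWords d q g) → BitVec W) ≃ (Fin 5 → Cell d q g → BitVec W) :=
  (Equiv.arrowCongr (keyIndex d q g).symm (Equiv.refl _)).trans (Equiv.curry _ _ _)

theorem keyEquiv_apply (d q g W : ℕ) (key : Fin (keyWords d q g) → BitVec W) (r : Fin 5)
    (c : Cell d q g) : keyEquiv d q g W key r c = key (keyIndex d q g (r, c)) := rfl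

/-- The graph on characters that is given by a list of words, of which only the last `g` bits are
used. -/
def charGraph {W : ℕ} (d e g : ℕ) (G : Fin (d * 2 ^ e) → BitVec W) :
    Fin d → Fin (2 ^ e) → BitVec g :=
  fun j a => (G (finProdFinEquiv (j, a))).setWidth g

/-- Its power, a graph on tuples of characters. -/
def wordGraph {W : ℕ} (d q e g : ℕ) (G : Fin (d * 2 ^ e) → BitVec W) (J : Fin q → Fin d)
    (y : Fin q → Fin (2 ^ e)) : Fin q → BitVec g :=
  fun i => charGraph d e g G (J i) (y i)

/-- The word `u` as a tuple of characters of `e` bits. -/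
def chars {w : ℕ} (q e : ℕ) (u : BitVec w) (i : Fin q) : Fin (2 ^ e) :=
  ⟨u.toNat / 2 ^ (e * (i : ℕ)) % 2 ^ e, Nat.mod_lt _ (by positivity)⟩

theorem chars_injective {w q e : ℕ} (h : w ≤ e * q) :
    Function.Injective (chars q e : BitVec w → Fin q → Fin (2 ^ e)) := by
  have hlt : ∀ u : BitVec w, u.toNat < (2 ^ e) ^ q := fun u => by
    rw [← pow_mul]
    exact u.isLt.trans_le (Nat.pow_le_pow_right (by norm_num) h)
  have hchars : ∀ u : BitVec w, chars q e u = finFunctionFinEquiv.symm ⟨u.toNat, hlt u⟩ := by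
    intro u
    ext i
    simp [chars, finFunctionFinEquiv, pow_mul]
  intro u v huv
  rw [hchars, hchars] at huv
  have h := finFunctionFinEquiv.symm.injective huv
  exact BitVec.eq_of_toNat_eq (Fin.mk.inj_iff.1 h)

/-- The word with the last `t` bits set. -/
def lowMask (w t : ℕ) : BitVec w := BitVec.ofNat w (2 ^ t - 1)

theorem getLsbD_lowMask (w t i : ℕ) :
    (lowMask w t).getLsbD i = (decide (i < w) && decide (i < t)) := by
  rw [lowMask, BitVec.getLsbD_ofNat, Nat.testBit_two_pow_sub_one]

/-- The length of the first two of the three parts of the words of `{0,1}^w`. -/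
def partBits (w : ℕ) : ℕ := w / 4 + 2

/-- The last `partBits w` bits. -/
def maskA (w : ℕ) : BitVec w := lowMask w (partBits w)

/-- The `partBits w` bits before these. -/
def maskB (w : ℕ) : BitVec w := lowMask w (2 * partBits w) ^^^ maskA w

/-- The remaining bits, about half of them. -/
def maskC (w : ℕ) : BitVec w := ~~~lowMask w (2 * partBits w)

/-- The round functions: `T` is the table. -/
def wordHash {w W : ℕ} (d q e g : ℕ) (G : Fin (d * 2 ^ e) → BitVec W) (T : Cell d q g → BitVec W)
    (u : BitVec w) : BitVec w :=
  (tableHash (wordGraph d q e g G) T (chars q e u)).setWidth w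

/-- The permutation with the given graph and key. -/
def graphPerm {W : ℕ} (w d q e g : ℕ) (G : Fin (d * 2 ^ e) → BitVec W)
    (key : Fin (keyWords d q g) → BitVec W) : Equiv.Perm (BitVec w) :=
  fiveRounds (fun r => wordHash d q e g G (keyEquiv d q g W key r)) (maskA w) (maskB w) (maskC w)

section OpLemmas

variable {W : ℕ}

theorem apply_shr_ofNat (y : BitVec W) {b : ℕ} (hb : b < 2 ^ W) :
    Op.shr.apply y (BitVec.ofNat W b) = BitVec.ofNat W (y.toNat / 2 ^ b) := by
  apply BitVec.eq_of_toNat_eq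
  rw [Op.apply, BitVec.toNat_ushiftRight, BitVec.toNat_ofNat, BitVec.toNat_ofNat,
    Nat.mod_eq_of_lt hb, Nat.shiftRight_eq_div_pow,
    Nat.mod_eq_of_lt ((Nat.div_le_self _ _).trans_lt y.isLt)]

theorem apply_shl_ofNat (a : ℕ) {b : ℕ} (hb : b < 2 ^ W) :
    Op.shl.apply (BitVec.ofNat W a) (BitVec.ofNat W b) = BitVec.ofNat W (a * 2 ^ b) := by
  apply BitVec.eq_of_toNat_eq
  rw [Op.apply, BitVec.toNat_shiftLeft, BitVec.toNat_ofNat, BitVec.toNat_ofNat,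
    BitVec.toNat_ofNat, Nat.mod_eq_of_lt hb, Nat.shiftLeft_eq, Nat.mod_mul_mod]

theorem apply_add_ofNat (a b : ℕ) :
    Op.add.apply (BitVec.ofNat W a) (BitVec.ofNat W b) = BitVec.ofNat W (a + b) :=
  (BitVec.ofNat_add a b).symm

theorem apply_mul_ofNat (a b : ℕ) :
    Op.mul.apply (BitVec.ofNat W a) (BitVec.ofNat W b) = BitVec.ofNat W (a * b) :=
  (BitVec.ofNat_mul a b).symm

theorem apply_sub_one_ofNat (t : ℕ) :
    Op.sub.apply (BitVec.ofNat W (2 ^ t)) (BitVec.ofNat W 1) = lowMask W t := by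
  rw [Op.apply, sub_eq_iff_eq_add, lowMask, ← BitVec.ofNat_add,
    Nat.sub_add_cancel Nat.one_le_two_pow]

theorem apply_and_lowMask (y : BitVec W) (t : ℕ) (ht : t ≤ W) :
    Op.and.apply y (lowMask W t) = BitVec.ofNat W (y.toNat % 2 ^ t) := by
  apply BitVec.eq_of_toNat_eq
  have h1 : 2 ^ t ≤ 2 ^ W := Nat.pow_le_pow_right (by norm_num) ht
  have h0 : 0 < 2 ^ t := by positivity
  rw [Op.apply, lowMask, BitVec.toNat_and, BitVec.toNat_ofNat, BitVec.toNat_ofNat,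
    Nat.mod_eq_of_lt (by omega), Nat.and_two_pow_sub_one_eq_mod,
    Nat.mod_eq_of_lt ((Nat.mod_lt _ h0).trans_le h1)]

theorem ofNat_sum {n : ℕ} (f : Fin n → ℕ) :
    ∑ i, BitVec.ofNat W (f i) = BitVec.ofNat W (∑ i, f i) := by
  have : ∀ a : ℕ, BitVec.ofNat W a = (a : BitVec W) := fun a => rfl
  simp only [this, Nat.cast_sum]

end OpLemmas

/-! ### Expressions for the parameters -/

section Expressions

variable (d q s : ℕ)

open WordRAM.Expr

/-- `charBits lg`. -/
def charBitsExpr : Expr := .op .shr (.load (.const 0)) (.const 1)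

/-- The power of two with the given exponent. -/
def pow2Expr (e : Expr) : Expr := .op .shl (.const 1) e

/-- The word with the given number of last bits set. -/
def lowMaskExpr (e : Expr) : Expr := .op .sub (pow2Expr e) (.const 1)

/-- `valBits s lg`. -/
def valBitsExpr : Expr := .op .shr (.load (.const 0)) (.const (s + 1))

/-- The value of the `i`-th character of the word `y`, on the edge `j` of the character graph. -/
def lookupExpr (j i : ℕ) (y : Expr) : Expr :=
  .op .and
    (.load (.op .add (.const 2) (.op .add (.op .mul (.const j) (pow2Expr charBitsExpr))
      (.op .and (.op .shr y (.op .mul charBitsExpr (.const i))) (lowMaskExpr charBitsExpr)))))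
    (lowMaskExpr (valBitsExpr s))

/-- The concatenation of the values of the characters. -/
def indexExpr (J : Fin q → Fin d) (y : Expr) : Expr :=
  sum (List.ofFn fun i : Fin q =>
    .op .shl (lookupExpr s (J i) i y) (.op .mul (valBitsExpr s) (.const i)))

/-- The function of round `r`, before truncation. -/
def hashExpr (r : ℕ) (y : Expr) : Expr :=
  sum (List.ofFn fun c : Fin (d ^ q) => .load
    (.op .add (.op .add (.const 2) (.op .mul (.const d) (pow2Expr charBitsExpr)))
      (.op .add (.op .mul (.const (r * d ^ q + c))
          (pow2Expr (.op .mul (valBitsExpr s) (.const q))))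
        (indexExpr d q s (finFunctionFinEquiv.symm c) y))))

/-- The mask of the `w` bits in use. -/
def fullExpr : Expr := lowMaskExpr (.load (.const 1))

/-- `partBits w`. -/
def partBitsExpr : Expr := .op .add (.op .shr (.load (.const 1)) (.const 2)) (.const 2)

/-- `maskA w`. -/
def maskAExpr : Expr := .op .and (lowMaskExpr partBitsExpr) fullExpr

/-- The union of `maskA w` and `maskB w`. -/
def maskABExpr : Expr := .op .and (lowMaskExpr (.op .mul (.const 2) partBitsExpr)) fullExpr

/-- `maskB w`. -/
def maskBExpr : Expr := .op .xor maskABExpr maskAExpr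

/-- The complement among the `w` bits in use. -/
def complExpr (N : Expr) : Expr := .op .xor fullExpr N

/-- Round `r`, modifying the bits in the mask `N`. -/
def roundExpr (r : ℕ) (N y : Expr) : Expr :=
  .op .xor y (.op .and (hashExpr d q s r (.op .and y (complExpr N))) N)

/-- The permutation. Its size depends only on `d`, `q` and `s`. -/
def permExpr : Expr :=
  roundExpr d q s 4 (complExpr maskABExpr) <| roundExpr d q s 3 maskBExpr <|
    roundExpr d q s 2 maskAExpr <| roundExpr d q s 1 (complExpr maskAExpr) <|
      roundExpr d q s 0 maskAExpr .inp

end Expressions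

/-- The memory holds the representation of a permutation: the parameters `lg` and `w`, the graph and
the key. -/
structure MemoryHolds {W : ℕ} (mem : BitVec W → BitVec W) (w d q e g lg : ℕ)
    (G : Fin (d * 2 ^ e) → BitVec W) (key : Fin (keyWords d q g) → BitVec W) : Prop where
  zero : mem (BitVec.ofNat W 0) = BitVec.ofNat W lg
  one : mem (BitVec.ofNat W 1) = BitVec.ofNat W w
  graph : ∀ i : Fin (d * 2 ^ e), mem (BitVec.ofNat W (2 + (i : ℕ))) = G i
  key : ∀ i : Fin (keyWords d q g), mem (BitVec.ofNat W (2 + d * 2 ^ e + (i : ℕ))) = key i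

/-- The numbers that occur in the evaluation of a permutation fit into words. -/
structure ParamsFit (W w q s lg : ℕ) : Prop where
  width : w ≤ W
  shift : s + 1 < 2 ^ W
  log : lg ≤ W
  chars : charBits lg * q < 2 ^ W
  vals : valBits s lg * q < 2 ^ W
  parts : 2 * partBits w < 2 ^ W

section Evaluation

variable {W w d q s lg : ℕ} {mem : BitVec W → BitVec W}
  {G : Fin (d * 2 ^ charBits lg) → BitVec W}
  {key : Fin (keyWords d q (valBits s lg)) → BitVec W}

open WordRAM.Expr

theorem lt_two_pow_of_le {a W : ℕ} (h : a ≤ W) : a < 2 ^ W := h.trans_lt Nat.lt_two_pow_self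

theorem charBits_le (lg : ℕ) : charBits lg ≤ lg := Nat.div_le_self _ _

theorem valBits_le (s lg : ℕ) : valBits s lg ≤ lg := Nat.div_le_self _ _

variable (hf : ParamsFit W w q s lg)
  (hm : MemoryHolds mem w d q (charBits lg) (valBits s lg) lg G key) (x : BitVec W)
include hf hm

theorem eval_charBitsExpr : charBitsExpr.eval x mem = BitVec.ofNat W (charBits lg) := by
  have h1 : 1 < 2 ^ W := by have := hf.shift; omega
  rw [charBitsExpr, eval, eval, eval, eval, hm.zero, apply_shr_ofNat _ h1, BitVec.toNat_ofNat,
    Nat.mod_eq_of_lt (lt_two_pow_of_le hf.log), pow_one, charBits]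

theorem eval_valBitsExpr : (valBitsExpr s).eval x mem = BitVec.ofNat W (valBits s lg) := by
  rw [valBitsExpr, eval, eval, eval, eval, hm.zero, apply_shr_ofNat _ hf.shift, BitVec.toNat_ofNat,
    Nat.mod_eq_of_lt (lt_two_pow_of_le hf.log), valBits]

omit hf hm in
theorem eval_pow2Expr {e : Expr} {a : ℕ} (he : e.eval x mem = BitVec.ofNat W a) (ha : a < 2 ^ W) :
    (pow2Expr e).eval x mem = BitVec.ofNat W (2 ^ a) := by
  rw [pow2Expr, eval, eval, he, apply_shl_ofNat _ ha, one_mul]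

omit hf hm in
theorem eval_lowMaskExpr {e : Expr} {a : ℕ} (he : e.eval x mem = BitVec.ofNat W a)
    (ha : a < 2 ^ W) : (lowMaskExpr e).eval x mem = lowMask W a := by
  rw [lowMaskExpr, eval, eval_pow2Expr x he ha, eval, apply_sub_one_ofNat]

theorem eval_lookupExpr (j : Fin d) (i : Fin q) {y : Expr} {u : BitVec w}
    (hy : (y.eval x mem).toNat = u.toNat) :
    (lookupExpr s j i y).eval x mem =
      BitVec.ofNat W (charGraph d (charBits lg) (valBits s lg) G j
        (chars q (charBits lg) u i)).toNat := by
  have he := eval_charBitsExpr hf hm x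
  have hlt := lt_two_pow_of_le ((charBits_le lg).trans hf.log)
  have hlt' := lt_two_pow_of_le ((valBits_le s lg).trans hf.log)
  have hi : charBits lg * i < 2 ^ W :=
    (Nat.mul_le_mul_left _ i.isLt.le).trans_lt hf.chars
  simp only [lookupExpr, eval]
  rw [he, eval_pow2Expr x he hlt, eval_lowMaskExpr x he hlt,
    eval_lowMaskExpr x (eval_valBitsExpr hf hm x) hlt', apply_mul_ofNat, apply_mul_ofNat,
    apply_shr_ofNat _ hi, apply_and_lowMask _ _ ((charBits_le lg).trans hf.log), apply_add_ofNat,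
    apply_add_ofNat, apply_and_lowMask _ _ ((valBits_le s lg).trans hf.log), hy, BitVec.toNat_ofNat,
    Nat.mod_eq_of_lt ((Nat.div_le_self _ _).trans_lt
      (u.isLt.trans_le (Nat.pow_le_pow_right (by norm_num) hf.width)))]
  have hg := hm.graph (finProdFinEquiv (j, chars q (charBits lg) u i))
  have hval : ((finProdFinEquiv (j, chars q (charBits lg) u i) : Fin _) : ℕ) =
      j * 2 ^ charBits lg + u.toNat / 2 ^ (charBits lg * i) % 2 ^ charBits lg := by
    simp only [finProdFinEquiv_apply_val, chars]; ring
  rw [hval] at hg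
  rw [hg, charGraph, BitVec.toNat_setWidth]

theorem eval_indexExpr (J : Fin q → Fin d) {y : Expr} {u : BitVec w}
    (hy : (y.eval x mem).toNat = u.toNat) :
    (indexExpr d q s J y).eval x mem =
      BitVec.ofNat W (∑ i, (wordGraph d q (charBits lg) (valBits s lg) G J
        (chars q (charBits lg) u) i).toNat * 2 ^ (valBits s lg * (i : ℕ))) := by
  rw [indexExpr, eval_sum_ofFn, ← ofNat_sum]
  refine Finset.sum_congr rfl fun i _ => ?_
  have hi : valBits s lg * i < 2 ^ W :=
    (Nat.mul_le_mul_left _ i.isLt.le).trans_lt hf.vals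
  rw [eval, eval_lookupExpr hf hm x _ _ hy, eval, eval, eval_valBitsExpr hf hm x, apply_mul_ofNat,
    apply_shl_ofNat _ hi]
  rfl

theorem eval_hashExpr (r : Fin 5) {y : Expr} {u : BitVec w}
    (hy : (y.eval x mem).toNat = u.toNat) :
    (hashExpr d q s r y).eval x mem =
      tableHash (wordGraph d q (charBits lg) (valBits s lg) G)
        (keyEquiv d q (valBits s lg) W key r) (chars q (charBits lg) u) := by
  rw [hashExpr, eval_sum_ofFn, tableHash_apply]
  refine Fintype.sum_equiv finFunctionFinEquiv.symm _ _ fun c => ?_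
  have he := eval_charBitsExpr hf hm x
  have hlt := lt_two_pow_of_le ((charBits_le lg).trans hf.log)
  have hgq : (Expr.op .mul (valBitsExpr s) (.const q)).eval x mem =
      BitVec.ofNat W (valBits s lg * q) := by
    rw [eval, eval_valBitsExpr hf hm x, eval, apply_mul_ofNat]
  simp only [eval]
  rw [eval_pow2Expr x he hlt,
    eval_pow2Expr x hgq hf.vals, eval_indexExpr hf hm x _ hy, apply_mul_ofNat, apply_mul_ofNat,
    apply_add_ofNat, apply_add_ofNat, apply_add_ofNat]
  rw [keyEquiv_apply, ← hm.key, keyIndex_val, Equiv.apply_symm_apply]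

theorem eval_fullExpr : fullExpr.eval x mem = (BitVec.allOnes w).setWidth W := by
  have h : (Expr.load (.const 1)).eval x mem = BitVec.ofNat W w := by rw [eval, eval, hm.one]
  rw [fullExpr, eval_lowMaskExpr x h (lt_two_pow_of_le hf.width)]
  apply BitVec.eq_of_getLsbD_eq
  intro i hi
  rw [getLsbD_lowMask, BitVec.getLsbD_setWidth, BitVec.getLsbD_allOnes]

theorem eval_partBitsExpr : partBitsExpr.eval x mem = BitVec.ofNat W (partBits w) := by
  have h2 : 2 < 2 ^ W := by have := hf.parts; unfold partBits at this; omega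
  rw [partBitsExpr, eval, eval, eval, eval, eval, eval, hm.one, apply_shr_ofNat _ h2,
    apply_add_ofNat, BitVec.toNat_ofNat, Nat.mod_eq_of_lt (lt_two_pow_of_le hf.width)]
  rfl

theorem eval_lowMaskExpr_and_full {e : Expr} {a : ℕ} (he : e.eval x mem = BitVec.ofNat W a)
    (ha : a < 2 ^ W) :
    (Expr.op .and (lowMaskExpr e) fullExpr).eval x mem = (lowMask w a).setWidth W := by
  rw [eval, eval_lowMaskExpr x he ha, eval_fullExpr hf hm x, Op.apply]
  apply BitVec.eq_of_getLsbD_eq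
  intro i hi
  rw [BitVec.getLsbD_and, getLsbD_lowMask, BitVec.getLsbD_setWidth, BitVec.getLsbD_allOnes,
    BitVec.getLsbD_setWidth, getLsbD_lowMask]
  cases decide (i < W) <;> cases decide (i < w) <;> simp

theorem eval_maskAExpr : maskAExpr.eval x mem = (maskA w).setWidth W :=
  eval_lowMaskExpr_and_full hf hm x (eval_partBitsExpr hf hm x) (by have := hf.parts; omega)

theorem eval_maskABExpr :
    maskABExpr.eval x mem = (lowMask w (2 * partBits w)).setWidth W :=
  eval_lowMaskExpr_and_full hf hm x
    (by rw [eval, eval_partBitsExpr hf hm x, eval, apply_mul_ofNat]) hf.parts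

theorem eval_maskBExpr : maskBExpr.eval x mem = (maskB w).setWidth W := by
  rw [maskBExpr, eval, eval_maskAExpr hf hm x, eval_maskABExpr hf hm x, Op.apply, maskB,
    BitVec.setWidth_xor]

theorem eval_complExpr {E : Expr} {N : BitVec w} (hE : E.eval x mem = N.setWidth W) :
    (complExpr E).eval x mem = (~~~N).setWidth W := by
  rw [complExpr, eval, hE, eval_fullExpr hf hm x, Op.apply, ← BitVec.setWidth_xor,
    BitVec.allOnes_xor]

theorem eval_roundExpr (r : Fin 5) {E y : Expr} {N u : BitVec w}
    (hE : E.eval x mem = N.setWidth W) (hy : y.eval x mem = u.setWidth W) :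
    (roundExpr d q s r E y).eval x mem =
      (feistelRound (wordHash d q (charBits lg) (valBits s lg) G
        (keyEquiv d q (valBits s lg) W key r)) N u).setWidth W := by
  have hin : ((Expr.op .and y (complExpr E)).eval x mem).toNat = (u &&& ~~~N).toNat := by
    rw [eval, hy, eval_complExpr hf hm x hE, Op.apply, ← BitVec.setWidth_and, BitVec.toNat_setWidth,
      Nat.mod_eq_of_lt (((u &&& ~~~N).isLt).trans_le
        (Nat.pow_le_pow_right (by norm_num) hf.width))]
  rw [roundExpr, eval, eval, eval_hashExpr hf hm x r hin, hE, hy, feistelRound_apply, wordHash,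
    Op.apply, Op.apply, BitVec.setWidth_xor]
  congr 1
  generalize tableHash (wordGraph d q (charBits lg) (valBits s lg) G)
    (keyEquiv d q (valBits s lg) W key r) (chars q (charBits lg) (u &&& ~~~N)) = H
  apply BitVec.eq_of_getLsbD_eq
  intro i hi
  simp only [BitVec.getLsbD_and, BitVec.getLsbD_setWidth, hi, decide_true, Bool.true_and]
  by_cases hiw : i < w
  · simp [hiw]
  · simp [hiw, BitVec.getLsbD_of_ge N i (by omega)]

theorem eval_permExpr (u : BitVec w) :
    (permExpr d q s).eval (u.setWidth W) mem =
      (graphPerm w d q (charBits lg) (valBits s lg) G key u).setWidth W := by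
  have hA := eval_maskAExpr hf hm (u.setWidth W)
  have hB := eval_maskBExpr hf hm (u.setWidth W)
  have hC := eval_complExpr hf hm (u.setWidth W) (eval_maskABExpr hf hm (u.setWidth W))
  have hA' := eval_complExpr hf hm (u.setWidth W) hA
  exact eval_roundExpr hf hm _ 4 hC <| eval_roundExpr hf hm _ 3 hB <|
    eval_roundExpr hf hm _ 2 hA <| eval_roundExpr hf hm _ 1 hA' <|
      eval_roundExpr hf hm _ 0 hA (by rw [eval])

end Evaluation

end WordRAM

/-! ### The generator -/

namespace WordRAM

/-- The generator. Instructions 1 to 3 determine `lg`, the next ones store `lg` and `w` in the first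
two memory cells and compute the lengths of the output, and the last four fill the rest of the
shared words with random words. -/
def genProgram (d q s : ℕ) : Program :=
  [.const 2 1,
   .op .shr 0 0 2, .op .add 3 3 2, .jumpLt 2 0 1,
   .store 4 3, .store 2 1,
   .op .shr 5 3 2, .op .shl 5 2 5, .const 6 d, .op .mul 5 5 6, .const 6 2, .op .add 0 6 5,
   .const 7 (s + 1), .op .shr 7 3 7, .const 8 q, .op .mul 7 7 8, .op .shl 7 2 7,
   .const 8 (5 * d ^ q), .op .mul 1 7 8,
   .rand 9, .store 6 9, .op .add 6 6 2, .jumpLt 6 0 19]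

section Generator

variable {W d q s : ℕ} (tape : ℕ → BitVec W)

/-- The first loop halves register `0` until it is `1` and counts in register `3`. -/
theorem run_log_loop (v : ℕ) (hv : 2 ≤ v) (hvW : v < 2 ^ W) (c : ℕ) (S : State W) (hpc : S.pc = 1)
    (h0 : S.reg 0 = BitVec.ofNat W v) (h2 : S.reg 2 = BitVec.ofNat W 1)
    (h3 : S.reg 3 = BitVec.ofNat W c) :
    let S' := run (genProgram d q s) tape (3 * Nat.log 2 v) S
    S'.pc = 4 ∧ S'.used = S.used ∧ S'.mem = S.mem ∧ S'.reg 3 = BitVec.ofNat W (c + Nat.log 2 v) ∧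
      ∀ i, i ≠ 0 → i ≠ 3 → S'.reg i = S.reg i := by
  induction v using Nat.strong_induction_on generalizing c S with
  | _ v ih =>
    have hlog : Nat.log 2 v = Nat.log 2 (v / 2) + 1 := Nat.log_of_one_lt_of_le (by norm_num) hv
    have h1W : 1 < 2 ^ W := by omega
    set S1 := run (genProgram d q s) tape 3 S with hS1
    have hS1' : S1 = { S with
        pc := if 1 < v / 2 then 1 else 4
        reg := Function.update (Function.update S.reg 0 (BitVec.ofNat W (v / 2))) 3
          (BitVec.ofNat W (c + 1)) } := by
      have hv' : (S.reg 0).toNat = v := by rw [h0, BitVec.toNat_ofNat, Nat.mod_eq_of_lt hvW]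
      have hshr : S.reg 0 >>> 1 = BitVec.ofNat W (v / 2) := by
        apply BitVec.eq_of_toNat_eq
        rw [BitVec.toNat_ushiftRight, hv', Nat.shiftRight_one, BitVec.toNat_ofNat,
          Nat.mod_eq_of_lt (by omega)]
      have hadd : S.reg 3 + 1#W = BitVec.ofNat W (c + 1) := by rw [h3, BitVec.ofNat_add]
      have hv2 : v / 2 % 2 ^ W = v / 2 := Nat.mod_eq_of_lt (by omega)
      have h1 : 1 % 2 ^ W = 1 := Nat.mod_eq_of_lt h1W
      rw [hS1, run_succ, run_succ, run_succ, run]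
      simp [step, genProgram, hpc, Op.apply, h2, h1, hshr, hadd, hv2]
    rw [hlog, mul_add, mul_one, add_comm, run_add, ← hS1]
    by_cases hlt : 1 < v / 2
    · have := ih (v / 2) (by omega) hlt (by omega) (c + 1) S1 (by rw [hS1', if_pos hlt])
        (by rw [hS1']; simp) (by rw [hS1']; simpa using h2) (by rw [hS1']; simp)
      obtain ⟨a1, a2, a3, a4, a5⟩ := this
      refine ⟨a1, a2.trans (by rw [hS1']), a3.trans (by rw [hS1']), ?_, fun i hi hi' => ?_⟩
      · rw [a4]; congr 1; ring
      · rw [a5 i hi hi', hS1']; simp [hi, hi']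
    · have hz : Nat.log 2 (v / 2) = 0 := Nat.log_of_lt (by omega)
      rw [hz]
      change S1.pc = 4 ∧ S1.used = _ ∧ S1.mem = _ ∧ S1.reg 3 = _ ∧ ∀ i, i ≠ 0 → i ≠ 3 →
        S1.reg i = S.reg i
      refine ⟨by rw [hS1', if_neg hlt], by rw [hS1'], by rw [hS1'], by rw [hS1']; simp,
        fun i hi hi' => ?_⟩
      rw [hS1']; simp [hi, hi']

/-- The straight-line part: the parameters are stored and the lengths of the output computed. -/
theorem run_params (lg w : ℕ) (hlg : lg ≤ W) (hs : s + 1 < 2 ^ W)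
    (hgq : valBits s lg * q < 2 ^ W) (S : State W) (hpc : S.pc = 4)
    (h1 : S.reg 1 = BitVec.ofNat W w) (h2 : S.reg 2 = BitVec.ofNat W 1)
    (h3 : S.reg 3 = BitVec.ofNat W lg) (h4 : S.reg 4 = BitVec.ofNat W 0) :
    let S' := run (genProgram d q s) tape 15 S
    S'.pc = 19 ∧ S'.used = S.used ∧
      S'.mem = Function.update (Function.update S.mem (BitVec.ofNat W 0) (BitVec.ofNat W lg))
        (BitVec.ofNat W 1) (BitVec.ofNat W w) ∧
      S'.reg 0 = BitVec.ofNat W (2 + d * 2 ^ charBits lg) ∧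
      S'.reg 1 = BitVec.ofNat W (keyWords d q (valBits s lg)) ∧
      S'.reg 2 = BitVec.ofNat W 1 ∧ S'.reg 6 = BitVec.ofNat W 2 := by
  have h1W : 1 < 2 ^ W := by omega
  have hlg' : lg < 2 ^ W := lt_two_pow_of_le hlg
  have e1 : Op.shr.apply (BitVec.ofNat W lg) (S.reg 2) = BitVec.ofNat W (charBits lg) := by
    rw [h2, apply_shr_ofNat _ h1W, BitVec.toNat_ofNat, Nat.mod_eq_of_lt hlg', pow_one, charBits]
  have e2 : Op.shl.apply (S.reg 2) (BitVec.ofNat W (charBits lg)) =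
      BitVec.ofNat W (2 ^ charBits lg) := by
    rw [h2, apply_shl_ofNat _ (lt_two_pow_of_le ((charBits_le lg).trans hlg)), one_mul]
  have e3 : Op.shr.apply (BitVec.ofNat W lg) (BitVec.ofNat W (s + 1)) =
      BitVec.ofNat W (valBits s lg) := by
    rw [apply_shr_ofNat _ hs, BitVec.toNat_ofNat, Nat.mod_eq_of_lt hlg', valBits]
  have e4 : Op.shl.apply (S.reg 2) (BitVec.ofNat W (valBits s lg * q)) =
      BitVec.ofNat W (2 ^ (valBits s lg * q)) := by
    rw [h2, apply_shl_ofNat _ hgq, one_mul]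
  have e5 : 2 ^ charBits lg * d = d * 2 ^ charBits lg := mul_comm _ _
  have e6 : 2 ^ (valBits s lg * q) * (5 * d ^ q) = keyWords d q (valBits s lg) := by
    rw [keyWords, pow_mul]; ring
  iterate 15 rw [run_succ]
  rw [run]
  simp [step, genProgram, hpc]
  refine ⟨by rw [h1, h2, h3, h4], ?_, ?_, h2⟩
  · rw [h3, e1, e2, apply_mul_ofNat, apply_add_ofNat, e5]
  · rw [h3, e3, apply_mul_ofNat, e4, apply_mul_ofNat, e6]

/-- The second loop copies random words to the memory. Register `6` points to the next cell, which
is two ahead of the number of random words read. -/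
theorem run_fill_loop (total : ℕ) (htot : total < 2 ^ W) (m : ℕ) (S : State W) (hpc : S.pc = 19)
    (hm : 2 + S.used + (m + 1) = total) (h0 : S.reg 0 = BitVec.ofNat W total)
    (h2 : S.reg 2 = BitVec.ofNat W 1) (h6 : S.reg 6 = BitVec.ofNat W (2 + S.used)) :
    let S' := run (genProgram d q s) tape (4 * (m + 1)) S
    S'.pc = 23 ∧ S'.reg 0 = S.reg 0 ∧ S'.reg 1 = S.reg 1 ∧
      (∀ i, S.used ≤ i → i < total - 2 → S'.mem (BitVec.ofNat W (2 + i)) = tape i) ∧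
      ∀ a < 2 + S.used, S'.mem (BitVec.ofNat W a) = S.mem (BitVec.ofNat W a) := by
  have hstep : ∀ S : State W, S.pc = 19 → 2 + S.used + 1 ≤ total →
      S.reg 0 = BitVec.ofNat W total → S.reg 2 = BitVec.ofNat W 1 →
      S.reg 6 = BitVec.ofNat W (2 + S.used) →
      run (genProgram d q s) tape 4 S =
        { pc := if 2 + S.used + 1 < total then 19 else 23
          used := S.used + 1
          reg := Function.update (Function.update S.reg 9 (tape S.used)) 6
            (BitVec.ofNat W (2 + (S.used + 1)))
          mem := Function.update S.mem (BitVec.ofNat W (2 + S.used)) (tape S.used) } := by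
    intro S hpc hle h0 h2 h6
    have e : Op.add.apply (BitVec.ofNat W (2 + S.used)) (BitVec.ofNat W 1) =
      BitVec.ofNat W (2 + (S.used + 1)) := by rw [apply_add_ofNat, add_assoc]
    have e1 : (2 + (S.used + 1)) % 2 ^ W = 2 + S.used + 1 := Nat.mod_eq_of_lt (by omega)
    have e2 : total % 2 ^ W = total := Nat.mod_eq_of_lt htot
    iterate 4 rw [run_succ]
    rw [run]
    simp [step, genProgram, hpc, h0, h2, h6, e, e1, e2]
  have hne : ∀ a b : ℕ, a < total → b < total → a ≠ b →
      BitVec.ofNat W a ≠ BitVec.ofNat W b := by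
    intro a b ha hb hab h
    have := congrArg BitVec.toNat h
    rw [BitVec.toNat_ofNat, BitVec.toNat_ofNat, Nat.mod_eq_of_lt (by omega),
      Nat.mod_eq_of_lt (by omega)] at this
    exact hab this
  induction m generalizing S with
  | zero =>
    rw [zero_add, mul_one, hstep S hpc (by omega) h0 h2 h6]
    refine ⟨if_neg (by omega), by simp, by simp, fun i hi hi' => ?_, fun a ha => ?_⟩
    · obtain rfl : i = S.used := by omega
      simp
    · exact Function.update_of_ne (hne _ _ (by omega) (by omega) (by omega)) _ _
  | succ m ih =>
    rw [mul_add, mul_one, add_comm, run_add]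
    have hS1 := hstep S hpc (by omega) h0 h2 h6
    set S1 := run (genProgram d q s) tape 4 S
    have hused : S1.used = S.used + 1 := by rw [hS1]
    have hmem : S1.mem = Function.update S.mem (BitVec.ofNat W (2 + S.used)) (tape S.used) := by
      rw [hS1]
    obtain ⟨a1, a2, a3, a4, a5⟩ := ih S1 (by rw [hS1]; exact if_pos (by omega))
      (by rw [hused]; omega)
      (by rw [hS1]; simpa using h0) (by rw [hS1]; simpa using h2) (by rw [hused, hS1]; simp)
    rw [hused] at a4 a5
    refine ⟨a1, a2.trans (by rw [hS1]; simp), a3.trans (by rw [hS1]; simp), fun i hi hi' => ?_,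
      fun a ha => ?_⟩
    · by_cases h : i = S.used
      · rw [h, a5 _ (by omega), hmem, Function.update_self]
      · exact a4 i (by omega) hi'
    · rw [a5 a (by omega), hmem, Function.update_of_ne (hne _ _ (by omega) (by omega) (by omega))]

/-- The generator halts after linearly many steps, with the expected output. -/
theorem run_genProgram {n w lg : ℕ} (hn : 2 ≤ n) (hlg : lg = Nat.log 2 n) (hnW : n < 2 ^ W)
    (hlgW : lg ≤ W) (hs : s + 1 < 2 ^ W) (hgq : valBits s lg * q < 2 ^ W)
    (htot : 2 + d * 2 ^ charBits lg < 2 ^ W) (hd : 0 < d) (t : ℕ)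
    (ht : 1 + 3 * lg + 15 + 4 * (d * 2 ^ charBits lg) ≤ t) :
    let S' := run (genProgram d q s) tape t (init (BitVec.ofNat W n) (BitVec.ofNat W w) [])
    Halted (genProgram d q s) S' ∧ S'.reg 0 = BitVec.ofNat W (2 + d * 2 ^ charBits lg) ∧
      S'.reg 1 = BitVec.ofNat W (keyWords d q (valBits s lg)) ∧
      S'.mem (BitVec.ofNat W 0) = BitVec.ofNat W lg ∧
      S'.mem (BitVec.ofNat W 1) = BitVec.ofNat W w ∧
      ∀ i < d * 2 ^ charBits lg, S'.mem (BitVec.ofNat W (2 + i)) = tape i := by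
  intro S'
  obtain ⟨m, hm⟩ : ∃ m, d * 2 ^ charBits lg = m + 1 :=
    Nat.exists_eq_add_one.2 (by positivity)
  obtain ⟨t', rfl⟩ := Nat.exists_eq_add_of_le ht
  have h1W : 1 < 2 ^ W := by omega
  obtain ⟨S1, hS1⟩ : ∃ S1, S1 = run (genProgram d q s) tape 1
    (init (BitVec.ofNat W n) (BitVec.ofNat W w) []) := ⟨_, rfl⟩
  obtain ⟨S2, hS2⟩ : ∃ S2, S2 = run (genProgram d q s) tape (3 * lg) S1 := ⟨_, rfl⟩
  obtain ⟨S3, hS3⟩ : ∃ S3, S3 = run (genProgram d q s) tape 15 S2 := ⟨_, rfl⟩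
  obtain ⟨S4, hS4⟩ : ∃ S4, S4 = run (genProgram d q s) tape (4 * (m + 1)) S3 := ⟨_, rfl⟩
  have hS' : S' = run (genProgram d q s) tape t' S4 := by
    simp only [S', run_add, hm, hS4, hS3, hS2, hS1]
  have hS1' : S1 = { init (BitVec.ofNat W n) (BitVec.ofNat W w) [] with
      pc := 1
      reg := Function.update (init (BitVec.ofNat W n) (BitVec.ofNat W w) []).reg 2
        (BitVec.ofNat W 1) } := by
    rw [hS1, run_one]
    simp [step, genProgram, init]
  obtain ⟨a1, a2, a3, a4, a5⟩ := run_log_loop (d := d) (q := q) (s := s) tape n hn hnW 0 S1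
    (by rw [hS1']) (by rw [hS1']; simp [init]) (by rw [hS1']; simp) (by rw [hS1']; simp [init])
  rw [← hlg, ← hS2] at a1 a2 a3 a4 a5
  obtain ⟨b1, b2, b3, b4, b5, b6, b7⟩ := run_params (d := d) (q := q) (s := s) tape lg w hlgW hs hgq
    S2 a1 (by rw [a5 1 (by norm_num) (by norm_num), hS1']; simp [init])
    (by rw [a5 2 (by norm_num) (by norm_num), hS1']; simp) (by rw [a4, zero_add])
    (by rw [a5 4 (by norm_num) (by norm_num), hS1']; simp [init])
  rw [← hS3] at b1 b2 b3 b4 b5 b6 b7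
  have hused : S3.used = 0 := by rw [b2, a2, hS1']; simp [init]
  obtain ⟨c1, c2, c3, c4, c5⟩ := run_fill_loop (d := d) (q := q) (s := s) tape
    (2 + d * 2 ^ charBits lg) htot m S3 b1 (by rw [hused]; omega) b4 b6 (by rw [hused, b7])
  rw [← hS4] at c1 c2 c3 c4 c5
  have hhalt : Halted (genProgram d q s) S4 := by
    unfold Halted
    rw [c1]
    simp [genProgram]
  rw [hS', run_of_halted _ _ _ _ hhalt]
  have h01 : BitVec.ofNat W 0 ≠ BitVec.ofNat W 1 := by
    intro h
    have := congrArg BitVec.toNat h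
    rw [BitVec.toNat_ofNat, BitVec.toNat_ofNat, Nat.mod_eq_of_lt h1W] at this
    simp at this
  refine ⟨hhalt, c2.trans b4, c3.trans b5, ?_, ?_, fun i hi => c4 i (by omega) (by omega)⟩
  · rw [c5 0 (by omega), b3, Function.update_of_ne h01, Function.update_self]
  · rw [c5 1 (by omega), b3, Function.update_self]

end Generator

end WordRAM

namespace WordRAM

/-! ### Collision probabilities of the masks -/

section Masks

theorem maskProb_lowMask {w t : ℕ} (ht : t ≤ w) : maskProb (lowMask w t) = (1 / 2) ^ t := by
  classical
  rw [maskProb_eq]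
  congr 1
  have : (Finset.univ.filter fun i : Fin w => (lowMask w t)[i] = true) =
      Finset.univ.image (Fin.castLE ht) := by
    ext i
    have := getLsbD_lowMask w t i
    rw [BitVec.getLsbD_eq_getElem i.isLt] at this
    simp only [Finset.mem_filter, Finset.mem_univ, true_and, Finset.mem_image, Fin.getElem_fin,
      this, i.isLt, decide_true, Bool.true_and, decide_eq_true_eq]
    constructor
    · intro h; exact ⟨⟨i, h⟩, rfl⟩
    · rintro ⟨j, rfl⟩; exact j.isLt
  rw [this, Finset.card_image_of_injective _ (Fin.castLE_injective ht), Finset.card_univ,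
    Fintype.card_fin]

theorem isMaskPartition (w : ℕ) : IsMaskPartition (maskA w) (maskB w) (maskC w) := by
  constructor
  all_goals
    apply BitVec.eq_of_getLsbD_eq
    intro i hi
    simp only [maskA, maskB, maskC, BitVec.getLsbD_and, BitVec.getLsbD_xor, BitVec.getLsbD_or,
      BitVec.getLsbD_not, getLsbD_lowMask, hi, decide_true, Bool.true_and,
      BitVec.getLsbD_allOnes, BitVec.ofNat_eq_ofNat, BitVec.getLsbD_zero]
    by_cases h1 : i < partBits w <;> by_cases h2 : i < 2 * partBits w <;> simp [h1, h2] <;> omega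

theorem maskProb_compl (w : ℕ) (N : BitVec w) {t : ℕ} (ht : t ≤ w)
    (hN : maskProb N = (1 / 2) ^ t) : maskProb (~~~N) = (1 / 2) ^ (w - t) := by
  have h := maskProb_compl_mul N
  have h2 : (1 / 2 : ℝ) ^ t ≠ 0 := by positivity
  rw [hN] at h
  apply mul_left_cancel₀ h2
  rw [h, ← pow_add, Nat.add_sub_cancel' ht, one_div_pow]

/-- All collision probabilities are at most `2 ^ (-w / 2 - 2)`. -/
theorem collision_bound {w : ℕ} (hw : 16 ≤ w) :
    maskProb (~~~maskA w) + maskProb (maskA w) * (maskProb (maskA w) + maskProb (maskC w)) +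
      maskProb (~~~maskC w) ≤ 1 / 2 ^ ((w : ℝ) / 2) := by
  set a := partBits w with ha
  have h2a : 2 * a ≤ w := by unfold partBits at ha; omega
  have hA : maskProb (maskA w) = (1 / 2) ^ a := maskProb_lowMask (by omega)
  have hA' := maskProb_compl w _ (by omega) hA
  have hlow := maskProb_lowMask h2a
  have hC : maskProb (maskC w) = (1 / 2) ^ (w - 2 * a) := maskProb_compl w _ h2a hlow
  have hC' : maskProb (~~~maskC w) = (1 / 2) ^ (2 * a) := by
    rw [maskC, BitVec.not_not]; exact hlow
  rw [hA, hA', hC, hC', mul_add, ← pow_add, ← pow_add]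
  have key : ∀ m : ℕ, w + 4 ≤ 2 * m → (1 / 2 : ℝ) ^ m ≤ 1 / 4 * (1 / 2 ^ ((w : ℝ) / 2)) := by
    intro m hm
    have hm' : (w : ℝ) + 4 ≤ 2 * m := by exact_mod_cast hm
    have h4 : (1 / 4 : ℝ) * (1 / 2 ^ ((w : ℝ) / 2)) = 1 / 2 ^ ((w : ℝ) / 2 + 2) := by
      rw [Real.rpow_add (by norm_num), Real.rpow_two]; norm_num [mul_comm]
    rw [h4, one_div_pow, ← Real.rpow_natCast]
    apply one_div_le_one_div_of_le (by positivity)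
    apply Real.rpow_le_rpow_of_exponent_le (by norm_num)
    linarith
  have ha4 : a = w / 4 + 2 := ha
  have k1 := key (w - a) (by omega)
  have k2 := key (a + a) (by omega)
  have k3 := key (a + (w - 2 * a)) (by omega)
  have k4 := key (2 * a) (by omega)
  linarith

end Masks

/-! ### The random collection of permutations -/

section Collection

variable {W T : ℕ}

/-- The graph on characters given by the random words, as a homomorphism. -/
def charGraphHom (W T d e g : ℕ) (hg : g ≤ W) :
    (Fin T → BitVec W) →+ (Fin d → Fin (2 ^ e) → BitVec g) :=
  AddMonoidHom.mk' (fun r => charGraph d e g fun i => extendTape r i) fun r r' => by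
    ext1 j; ext1 a
    simp only [charGraph, Pi.add_apply, extendTape]
    split_ifs
    · exact BitVec.setWidth_add _ _ hg
    · simp

theorem charGraphHom_apply {d e g : ℕ} (hg : g ≤ W) (r : Fin T → BitVec W) :
    charGraphHom W T d e g hg r = charGraph d e g fun i => extendTape r i := rfl

theorem charGraphHom_surjective {d e g : ℕ} (hg : g ≤ W) (hT : d * 2 ^ e ≤ T) :
    Function.Surjective (charGraphHom W T d e g hg) := by
  intro f
  refine ⟨fun t => if h : (t : ℕ) < d * 2 ^ e then
    (f (finProdFinEquiv.symm ⟨t, h⟩).1 (finProdFinEquiv.symm ⟨t, h⟩).2).setWidth W else 0, ?_⟩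
  ext1 j; ext1 a
  rw [charGraphHom_apply]
  have hlt := (finProdFinEquiv (j, a)).isLt
  rw [charGraph, extendTape, dif_pos (hlt.trans_le hT), dif_pos hlt]
  simp only [Fin.eta, Equiv.symm_apply_apply]
  rw [BitVec.setWidth_setWidth_of_le _ hg, BitVec.setWidth_eq]

/-- The character graph of the generator fails to have unique neighbours with small probability. -/
theorem unifProb_charGraph_le {d e g k : ℕ} (hg : g ≤ W) (hT : 2 * d * 2 ^ e ≤ T) {y : ℝ}
    (hy : ((k : ℝ) ^ 2 / 2 ^ g) ^ d ≤ y) (hey : 2 ^ e * y ≤ 1) :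
    unifProb (fun r : Fin T → BitVec W =>
      ¬ HasUniqueNeighbors k (charGraph (2 * d) e g fun i => extendTape r i)) ≤
      2 * (2 ^ e * y) := by
  have h := unifProb_not_hasUniqueNeighbors_le (charGraphHom W T (2 * d) e g hg)
    (charGraphHom_surjective hg hT) k d (by simp) (y := y)
    (by rw [card_bitVec]; exact_mod_cast hy) (by simpa using hey)
  simpa [charGraphHom_apply] using h

/-- With unique neighbours, the collection of permutations is `k`-wise almost independent. -/
theorem kWiseDependent_graphPerm {w d q e g k : ℕ} (hd : 0 < d) (hw : w ≤ W)
    (hq : w ≤ e * q) (hk : 16 ≤ k) (G : Fin (d * 2 ^ e) → BitVec W)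
    (hG : HasUniqueNeighbors k (charGraph d e g G)) :
    KWiseDependent k ((k : ℝ) ^ 2 / 2 ^ ((w : ℝ) / 2) + (k : ℝ) ^ 2 / 2 ^ (w : ℝ))
      (graphPerm w d q e g G) := by
  by_cases hw16 : 16 ≤ w
  · have : Nonempty (Fin d) := ⟨⟨0, hd⟩⟩
    have hh : KWiseUniform k (wordHash (w := w) d q e g G) :=
      (hG.pi (ι := Fin q)).kWiseUniform hw _ (chars_injective hq)
    refine (hh.kWiseDependent_fiveRounds (isMaskPartition w) ?_).comp_equiv (keyEquiv d q g W)
    rw [Real.rpow_natCast, div_eq_mul_one_div ((k : ℝ) ^ 2) (2 ^ ((w : ℝ) / 2))]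
    gcongr
    exact collision_bound hw16
  · -- for short words the bound is trivial
    refine KWiseDependent.of_one_le ?_ _
    have hk' : (16 : ℝ) ≤ k := by exact_mod_cast hk
    have hw' : (w : ℝ) / 2 ≤ (8 : ℕ) := by
      have : (w : ℝ) ≤ 16 := by exact_mod_cast (by omega : w ≤ 16)
      push_cast; linarith
    have h1 : (2 : ℝ) ^ ((w : ℝ) / 2) ≤ (2 : ℝ) ^ ((8 : ℕ) : ℝ) :=
      Real.rpow_le_rpow_of_exponent_le (by norm_num) hw'
    rw [Real.rpow_natCast] at h1
    have h2 : 1 ≤ (k : ℝ) ^ 2 / 2 ^ ((w : ℝ) / 2) := by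
      rw [one_le_div (by positivity)]
      nlinarith
    have h3 : 0 ≤ (k : ℝ) ^ 2 / 2 ^ (w : ℝ) := by positivity
    linarith

/-- The collection that the generator outputs. -/
def collection (w d q s lg : ℕ) (r : Fin T → BitVec W) : PermCollection W w where
  shared := BitVec.ofNat W lg :: BitVec.ofNat W w ::
    List.ofFn fun i : Fin (d * 2 ^ charBits lg) => extendTape r i
  keyLen := keyWords d q (valBits s lg)
  perm := graphPerm w d q (charBits lg) (valBits s lg) fun i => extendTape r i

variable {w d q s lg : ℕ}

theorem reprBits_collection (r : Fin T → BitVec W) :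
    (collection w d q s lg r).reprBits =
      (d * 2 ^ charBits lg + 2 + keyWords d q (valBits s lg)) * W := by
  simp [PermCollection.reprBits, collection]

theorem evaluatedBy_collection (hf : ParamsFit W w q s lg)
    (htot : d * 2 ^ charBits lg + 2 + keyWords d q (valBits s lg) ≤ 2 ^ W)
    (r : Fin T → BitVec W) :
    (collection w d q s lg r).EvaluatedBy (permExpr d q s).program
      (permExpr d q s).program.length := by
  intro key x
  have hm : MemoryHolds (init (x.setWidth W) 0 ((collection w d q s lg r).repr key)).mem w d q
      (charBits lg) (valBits s lg) lg (fun i => extendTape r i) key := by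
    have hlen : ∀ i < d * 2 ^ charBits lg + 2 + keyWords d q (valBits s lg),
        (BitVec.ofNat W i).toNat = i := fun i hi => by
      rw [BitVec.toNat_ofNat, Nat.mod_eq_of_lt (by omega)]
    constructor
    · simp only [init]
      rw [hlen 0 (by omega)]
      simp [PermCollection.repr, collection]
    · simp only [init]
      rw [hlen 1 (by omega)]
      simp [PermCollection.repr, collection]
    · intro i
      have hi := i.isLt
      simp only [init]
      rw [hlen _ (by omega), add_comm]
      simp [PermCollection.repr, collection, List.getD_eq_getElem?_getD, List.getElem?_append, hi]
    · intro i
      have hi : (i : ℕ) < keyWords d q (valBits s lg) := i.isLt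
      simp only [init]
      rw [hlen _ (by omega)]
      have hlen' : (collection w d q s lg r).shared.length = 2 + d * 2 ^ charBits lg := by
        simp [collection]; ring
      rw [PermCollection.repr, List.getD_eq_getElem?_getD,
        List.getElem?_append_right (by rw [hlen']; omega), hlen', Nat.add_sub_cancel_left,
        List.getElem?_ofFn]
      split_ifs with h
      · rfl
      · exact absurd hi h
  obtain ⟨h1, h2⟩ := (permExpr d q s).run_program (fun _ => 0)
    (init (x.setWidth W) 0 ((collection w d q s lg r).repr key)) rfl
  refine ⟨h1, h2.trans ?_⟩
  exact eval_permExpr hf hm x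

theorem outputs_collection {n w T : ℕ} (hn : 2 ≤ n)
    (hf : ParamsFit (wordLength n w) w q s (Nat.log 2 n))
    (htot : d * 2 ^ charBits (Nat.log 2 n) + 2 + keyWords d q (valBits s (Nat.log 2 n)) <
      2 ^ wordLength n w) (hd : 0 < d)
    (hT : 1 + 3 * Nat.log 2 n + 15 + 4 * (d * 2 ^ charBits (Nat.log 2 n)) ≤ T)
    (r : Fin T → BitVec (wordLength n w)) :
    Outputs (genProgram d q s) r (collection w d q s (Nat.log 2 n) r) := by
  have hnW : n < 2 ^ wordLength n w := (Nat.lt_size_self n).trans_le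
    (Nat.pow_le_pow_right (by norm_num) (le_max_right _ _))
  obtain ⟨h1, h2, h3, h4, h5, h6⟩ := run_genProgram (d := d) (q := q) (s := s) (w := w)
    (extendTape r) hn rfl hnW hf.log hf.shift hf.vals (by omega) hd T hT
  refine ⟨h1, ?_, ?_⟩
  · have h2' := congrArg BitVec.toNat h2
    rw [BitVec.toNat_ofNat, Nat.mod_eq_of_lt (by omega)] at h2'
    apply List.ext_getElem
    · rw [List.length_ofFn]
      refine Eq.trans ?_ h2'.symm
      simp [collection]; ring
    · intro i hi hi'
      rw [List.getElem_ofFn]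
      match i with
      | 0 => exact h4.symm
      | 1 => exact h5.symm
      | i + 2 =>
        have hlt : i < d * 2 ^ charBits (Nat.log 2 n) := by
          simpa [collection] using hi
        have := h6 i hlt
        rw [add_comm] at this
        refine Eq.trans ?_ this.symm
        simp [collection]
  · have h3' := congrArg BitVec.toNat h3
    rw [BitVec.toNat_ofNat, Nat.mod_eq_of_lt (by omega)] at h3'
    exact h3'.symm

end Collection

end WordRAM

/-! ### The choice of the parameters -/

namespace WordRAM

open Filter

theorem logb_lt_log_add_one {n : ℕ} (hn : 0 < n) : Real.logb 2 n < Nat.log 2 n + 1 := by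
  rw [Real.logb_lt_iff_lt_rpow (by norm_num) (by exact_mod_cast hn)]
  have := Nat.lt_pow_succ_log_self (b := 2) (by norm_num) n
  exact_mod_cast this

theorem log_le_logb {n : ℕ} (hn : 0 < n) : (Nat.log 2 n : ℝ) ≤ Real.logb 2 n := by
  rw [Real.le_logb_iff_rpow_le (by norm_num) (by exact_mod_cast hn), Real.rpow_natCast]
  exact_mod_cast Nat.pow_log_le_self 2 hn.ne'

theorem two_pow_le_sqrt {n a : ℕ} (hn : 0 < n) (ha : a * 2 ≤ Nat.log 2 n) :
    (2 : ℝ) ^ a ≤ (n : ℝ) ^ (1 / 2 : ℝ) := by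
  rw [← Real.sqrt_eq_rpow]
  refine Real.le_sqrt_of_sq_le ?_
  rw [← pow_mul]
  have h : 2 ^ (a * 2) ≤ n := (Nat.pow_le_pow_right (by norm_num) ha).trans
    (Nat.pow_log_le_self 2 hn.ne')
  exact_mod_cast h

theorem charBits_mul_two_le (lg : ℕ) : charBits lg * 2 ≤ lg := Nat.div_mul_le_self _ _

theorem valBits_mul_le (s lg : ℕ) : valBits s lg * 2 ^ s * 2 ≤ lg := by
  rw [mul_assoc, ← pow_succ]
  exact Nat.div_mul_le_self _ _

/-- A word of at most `C * log₂ n` bits is covered by `2 ^ (⌈C⌉ + 3)` characters. -/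
theorem le_charBits_mul {C : ℝ} {n w : ℕ} (hn : 4 ≤ n) (hw : (w : ℝ) ≤ C * Real.logb 2 n) :
    w ≤ charBits (Nat.log 2 n) * 2 ^ (⌈C⌉₊ + 3) := by
  set lg := Nat.log 2 n with hlg
  have h2 : 2 ≤ lg := Nat.le_log_of_pow_le (by norm_num) (by simpa using hn)
  have hCw : (w : ℝ) ≤ (⌈C⌉₊ * (lg + 1) : ℕ) := by
    push_cast
    have h0 : 0 ≤ Real.logb 2 n := Real.logb_nonneg (by norm_num) (by
      have : (4 : ℝ) ≤ n := by exact_mod_cast hn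
      linarith)
    exact hw.trans (mul_le_mul (Nat.le_ceil C) (logb_lt_log_add_one (by omega)).le h0
      (by positivity))
  have hw' : w ≤ ⌈C⌉₊ * (lg + 1) := by exact_mod_cast hCw
  have h3 : ⌈C⌉₊ ≤ 2 ^ ⌈C⌉₊ := Nat.lt_two_pow_self.le
  have h4 : lg + 1 ≤ charBits lg * 8 := by unfold charBits; omega
  calc w ≤ ⌈C⌉₊ * (lg + 1) := hw'
    _ ≤ 2 ^ ⌈C⌉₊ * (charBits lg * 8) := Nat.mul_le_mul h3 h4
    _ = _ := by rw [pow_add]; ring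

/-- The number of values for a character exceeds `k ^ 2` by a factor of a power of `n`. -/
theorem sq_div_two_pow_valBits_le {n k s : ℕ} (hn : 1 < n) (hk : 2 ≤ k)
    (hkn : (k : ℝ) ≤ (n : ℝ) ^ (1 / (8 * 2 ^ s) : ℝ)) :
    (k : ℝ) ^ 2 / 2 ^ valBits s (Nat.log 2 n) ≤ (n : ℝ) ^ (-(1 / (8 * 2 ^ s)) : ℝ) := by
  set g := valBits s (Nat.log 2 n) with hg
  have hn0 : (0 : ℝ) < n := by exact_mod_cast (by omega : 0 < n)
  set b : ℝ := (n : ℝ) ^ (1 / (8 * 2 ^ s) : ℝ) with hb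
  have hb0 : 0 < b := by positivity
  have hb2 : (2 : ℝ) ≤ b := le_trans (by exact_mod_cast hk) hkn
  have hlt : n < 2 ^ ((g + 1) * 2 ^ (s + 1)) := by
    have h1 : Nat.log 2 n < (g + 1) * 2 ^ (s + 1) := by
      rw [hg, valBits, mul_comm]
      exact Nat.lt_mul_div_succ _ (by positivity)
    exact (Nat.lt_pow_succ_log_self (by norm_num) n).trans_le
      (Nat.pow_le_pow_right (by norm_num) h1)
  have hpow : b ^ (4 * 2 ^ (s + 1)) = n := by
    rw [hb, ← Real.rpow_natCast, ← Real.rpow_mul hn0.le]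
    push_cast
    rw [pow_succ]
    have : (2 : ℝ) ^ s ≠ 0 := by positivity
    have h : (1 / (8 * 2 ^ s) * (4 * (2 ^ s * 2)) : ℝ) = 1 := by field_simp; norm_num
    rw [h, Real.rpow_one]
  have hb4 : b ^ 4 ≤ 2 ^ (g + 1) := by
    refine le_of_pow_le_pow_left₀ (n := 2 ^ (s + 1)) (by positivity) (by positivity) ?_
    rw [← pow_mul, ← pow_mul, hpow]
    exact_mod_cast hlt.le
  rw [Real.rpow_neg hn0.le, ← hb, div_le_iff₀ (by positivity), inv_mul_eq_div, le_div_iff₀ hb0]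
  have h5 : (k : ℝ) ^ 2 * b ≤ b ^ 2 * b := by gcongr
  have h6 : 2 * b ^ 3 ≤ b ^ 4 := by nlinarith [pow_pos hb0 3]
  rw [pow_succ (2 : ℝ) g] at hb4
  nlinarith

/-- Polylogarithmic factors are small. -/
theorem eventually_mul_log_le (K K' : ℝ) :
    ∀ᶠ n : ℕ in atTop, K * (K' * Real.logb 2 n + 1) ≤ (n : ℝ) ^ (1 / 4 : ℝ) := by
  have h1 : (fun x : ℝ => K * (K' * Real.logb 2 x + 1)) =o[atTop]
      fun x : ℝ => x ^ (1 / 4 : ℝ) := by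
    refine Asymptotics.IsLittleO.const_mul_left (Asymptotics.IsLittleO.add ?_ ?_) K
    · refine Asymptotics.IsLittleO.const_mul_left ?_ K'
      have := (isLittleO_log_rpow_atTop (r := 1 / 4) (by norm_num)).const_mul_left (Real.log 2)⁻¹
      refine this.congr_left fun x => ?_
      rw [Real.logb]; ring
    · refine (Asymptotics.isLittleO_const_left).2 (Or.inr ?_)
      exact tendsto_norm_atTop_atTop.comp (tendsto_rpow_atTop (by norm_num))
  have h2 := (h1.comp_tendsto tendsto_natCast_atTop_atTop).bound (c := 1) (by norm_num)
  filter_upwards [h2] with n hn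
  simp only [Function.comp_apply, one_mul] at hn
  rw [Real.norm_of_nonneg (by positivity : (0 : ℝ) ≤ (n : ℝ) ^ (1 / 4 : ℝ))] at hn
  exact (le_abs_self _).trans hn

/-- The size of the representation. -/
theorem representation_bound {C : ℝ} (hC : 0 < C) {n w d s : ℕ} (hn : 2 ≤ n)
    (hw : (w : ℝ) ≤ C * Real.logb 2 n)
    (hlarge : ((d + 2 + 5 * d ^ 2 ^ s : ℕ) : ℝ) * ((C + 1) * Real.logb 2 n + 1) ≤
      (n : ℝ) ^ (1 / 4 : ℝ)) :
    (((d * 2 ^ charBits (Nat.log 2 n) + 2 + keyWords d (2 ^ s) (valBits s (Nat.log 2 n))) *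
      wordLength n w : ℕ) : ℝ) ≤ (n : ℝ) ^ (3 / 4 : ℝ) := by
  set lg := Nat.log 2 n with hlg
  have hn0 : (0 : ℝ) < n := by exact_mod_cast (by omega : 0 < n)
  have h1n : (1 : ℝ) ≤ n := by exact_mod_cast (by omega : 1 ≤ n)
  have hlog0 : 0 ≤ Real.logb 2 n := Real.logb_nonneg (by norm_num) h1n
  have hE := two_pow_le_sqrt (by omega : 0 < n) (charBits_mul_two_le lg)
  have hM := two_pow_le_sqrt (by omega : 0 < n) (valBits_mul_le s lg)
  set R : ℝ := (n : ℝ) ^ (1 / 2 : ℝ) with hR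
  have hR1 : 1 ≤ R := Real.one_le_rpow h1n (by norm_num)
  have hW : (wordLength n w : ℝ) ≤ (C + 1) * Real.logb 2 n + 1 := by
    rw [wordLength, Nat.cast_max]
    have hsz : (n.size : ℝ) ≤ Real.logb 2 n + 1 := by
      have : n.size ≤ lg + 1 := Nat.size_le.2 (Nat.lt_pow_succ_log_self (by norm_num) n)
      have h' : (n.size : ℝ) ≤ lg + 1 := by exact_mod_cast this
      linarith [log_le_logb (by omega : 0 < n)]
    have : 0 ≤ C * Real.logb 2 n := by positivity
    refine max_le (by linarith) (by linarith)
  have hcount : ((d * 2 ^ charBits lg + 2 + keyWords d (2 ^ s) (valBits s lg) : ℕ) : ℝ) ≤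
      ((d + 2 + 5 * d ^ 2 ^ s : ℕ) : ℝ) * R := by
    rw [keyWords, ← pow_mul]
    push_cast
    have e1 : (d : ℝ) * 2 ^ charBits lg ≤ d * R := by gcongr
    have e2 : (d : ℝ) ^ 2 ^ s * 2 ^ (valBits s lg * 2 ^ s) ≤ (d : ℝ) ^ 2 ^ s * R := by gcongr
    nlinarith
  rw [Nat.cast_mul]
  calc _ ≤ (((d + 2 + 5 * d ^ 2 ^ s : ℕ) : ℝ) * R) * ((C + 1) * Real.logb 2 n + 1) := by gcongr
    _ = R * (((d + 2 + 5 * d ^ 2 ^ s : ℕ) : ℝ) * ((C + 1) * Real.logb 2 n + 1)) := by ring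
    _ ≤ R * (n : ℝ) ^ (1 / 4 : ℝ) := by gcongr
    _ = _ := by rw [hR, ← Real.rpow_add hn0]; norm_num

theorem paramsFit {n w s : ℕ} (hn : 4 ≤ n) (hs : s + 1 ≤ n)
    (hlarge : Nat.log 2 n * 2 ^ s ≤ n) :
    ParamsFit (wordLength n w) w (2 ^ s) s (Nat.log 2 n) := by
  have hsize : n.size ≤ wordLength n w := le_max_right _ _
  have hw : w ≤ wordLength n w := le_max_left _ _
  have hnW : n < 2 ^ wordLength n w :=
    (Nat.lt_size_self n).trans_le (Nat.pow_le_pow_right (by norm_num) hsize)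
  have hlog : Nat.log 2 n < n.size :=
    Nat.log_lt_of_lt_pow (by omega) (Nat.lt_size_self n)
  have h3 : 3 ≤ n.size := by
    have : 2 ^ 2 < 2 ^ n.size := lt_of_le_of_lt (by simpa using hn) (Nat.lt_size_self n)
    exact (Nat.pow_lt_pow_iff_right (by norm_num)).1 this
  refine ⟨hw, by omega, by omega, ?_, ?_, ?_⟩
  · exact ((Nat.mul_le_mul_right _ (charBits_le _)).trans hlarge).trans_lt hnW
  · exact ((Nat.mul_le_mul_right _ (valBits_le _ _)).trans hlarge).trans_lt hnW
  · generalize wordLength n w = W at *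
    have hpow : ∀ W, 3 ≤ W → W + 4 < 2 ^ W := by
      intro W hW
      induction W, hW using Nat.le_induction with
      | base => norm_num
      | succ W hW ih => rw [pow_succ]; omega
    have := hpow W (by omega)
    unfold partBits
    omega

end WordRAM

open WordRAM

theorem mainTheorem6 (C : ℝ) (hC : 0 < C) :
    ∃ α β : ℝ, 0 < α ∧ α < β ∧ β < 1 ∧
    ∀ c : ℝ, 1 < c →
    ∃ (gen ev : WordRAM.Program) (p : Polynomial ℕ) (t n₀ : ℕ),
    ∀ n w k : ℕ, n₀ ≤ n → (w : ℝ) ≤ C * Real.logb 2 n → k = ⌊(n : ℝ) ^ α⌋₊ →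
    ∃ Coll : (Fin (p.eval n) → BitVec (WordRAM.wordLength n w)) →
        WordRAM.PermCollection (WordRAM.wordLength n w) w,
      (∀ r, WordRAM.Outputs gen r (Coll r)) ∧
      1 - (n : ℝ) ^ (-c) ≤
        unifProb (fun r =>
          KWiseDependent k ((k : ℝ) ^ 2 / 2 ^ ((w : ℝ) / 2) + (k : ℝ) ^ 2 / 2 ^ (w : ℝ))
            (Coll r).perm) ∧
      (∀ r, ((Coll r).reprBits : ℝ) ≤ (n : ℝ) ^ β ∧ (Coll r).EvaluatedBy ev t) := by
  set s := ⌈C⌉₊ + 3 with hs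
  have hα0 : (0 : ℝ) < 1 / (8 * 2 ^ s) := by positivity
  refine ⟨1 / (8 * 2 ^ s), 3 / 4, hα0, ?_, by norm_num, fun c hc => ?_⟩
  · have : (1 : ℝ) ≤ 2 ^ s := one_le_pow₀ (by norm_num)
    rw [div_lt_iff₀ (by positivity)]
    linarith
  -- half the degree of the graph: each power of `k ^ 2 / 2 ^ g ≤ n ^ (-1 / (8 * 2 ^ s))` counts,
  -- and their product has to be at most `n ^ (-(c + 2))`
  set d := 8 * 2 ^ s * (⌈c⌉₊ + 2) with hd
  have hd0 : 0 < d := by positivity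
  have hev1 := eventually_mul_log_le ((2 * d + 2 + 5 * (2 * d) ^ 2 ^ s : ℕ) : ℝ) (C + 1)
  have hev2 := ((tendsto_rpow_atTop hα0).comp tendsto_natCast_atTop_atTop).eventually_ge_atTop 16
  obtain ⟨n₀, hn₀⟩ := Filter.eventually_atTop.1
    ((hev1.and hev2).and (Filter.eventually_ge_atTop (s + 4)))
  refine ⟨genProgram (2 * d) (2 ^ s) s, (permExpr (2 * d) (2 ^ s) s).program,
    Polynomial.C (8 * d + 3) * Polynomial.X + Polynomial.C 16,
    (permExpr (2 * d) (2 ^ s) s).program.length, n₀, fun n w k hn hw hk => ?_⟩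
  obtain ⟨⟨hlarge, hk16⟩, hns⟩ := hn₀ n hn
  simp only [Function.comp_apply] at hk16
  have hn4 : 4 ≤ n := by omega
  have hn0 : (0 : ℝ) < n := by exact_mod_cast (by omega : 0 < n)
  have h1n : (1 : ℝ) ≤ n := by exact_mod_cast (by omega : 1 ≤ n)
  have hT : (Polynomial.C (8 * d + 3) * Polynomial.X + Polynomial.C 16 : Polynomial ℕ).eval n =
      (8 * d + 3) * n + 16 := by simp
  generalize (Polynomial.C (8 * d + 3) * Polynomial.X + Polynomial.C 16 : Polynomial ℕ).eval n = T
    at hT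
  set lg := Nat.log 2 n with hlg
  have hk16' : 16 ≤ k := by rw [hk]; exact Nat.le_floor (by exact_mod_cast hk16)
  have hkle : (k : ℝ) ≤ (n : ℝ) ^ (1 / (8 * 2 ^ s) : ℝ) := by
    rw [hk]; exact Nat.floor_le (by positivity)
  have hlgn : 2 ^ lg ≤ n := Nat.pow_log_le_self 2 (by omega)
  have hlgn' : lg ≤ n := Nat.lt_two_pow_self.le.trans hlgn
  have hEn : 2 ^ charBits lg ≤ n :=
    (Nat.pow_le_pow_right (by norm_num) (charBits_le lg)).trans hlgn
  have hrepr := representation_bound hC (by omega) hw hlarge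
  have hW1 : 1 ≤ wordLength n w := (Nat.size_pos.2 (by omega)).trans_le (le_max_right _ _)
  have hnW : n < 2 ^ wordLength n w :=
    (Nat.lt_size_self n).trans_le (Nat.pow_le_pow_right (by norm_num) (le_max_right _ _))
  have htot : 2 * d * 2 ^ charBits lg + 2 + keyWords (2 * d) (2 ^ s) (valBits s lg) ≤ n := by
    have h1 : (n : ℝ) ^ (3 / 4 : ℝ) ≤ n := by
      conv_rhs => rw [← Real.rpow_one (n : ℝ)]
      exact Real.rpow_le_rpow_of_exponent_le h1n (by norm_num)
    have h2 := hrepr.trans h1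
    exact (Nat.le_mul_of_pos_right _ hW1).trans (by exact_mod_cast h2)
  have hfit : ParamsFit (wordLength n w) w (2 ^ s) s lg := by
    refine paramsFit hn4 (by omega) ?_
    have h1 : (lg : ℝ) * 2 ^ s ≤ (n : ℝ) ^ (1 / 4 : ℝ) := by
      refine le_trans ?_ hlarge
      have h2 : ((2 ^ s : ℕ) : ℝ) ≤ ((2 * d + 2 + 5 * (2 * d) ^ 2 ^ s : ℕ) : ℝ) := by
        have : 2 ^ s ≤ 2 * d := by
          rw [hd]; nlinarith [Nat.pos_of_ne_zero (pow_ne_zero s (two_ne_zero (α := ℕ)))]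
        exact_mod_cast this.trans (by omega)
      have h3 : (lg : ℝ) ≤ (C + 1) * Real.logb 2 n + 1 := by
        have := log_le_logb (by omega : 0 < n)
        have h0 : 0 ≤ Real.logb 2 n := Real.logb_nonneg (by norm_num) h1n
        nlinarith
      push_cast at h2
      rw [mul_comm]
      push_cast
      exact mul_le_mul h2 h3 (by positivity) (by positivity)
    have h2 : (n : ℝ) ^ (1 / 4 : ℝ) ≤ n := by
      conv_rhs => rw [← Real.rpow_one (n : ℝ)]
      exact Real.rpow_le_rpow_of_exponent_le h1n (by norm_num)
    exact_mod_cast h1.trans h2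
  refine ⟨collection w (2 * d) (2 ^ s) s lg, fun r => ?_, ?_, fun r => ⟨?_, ?_⟩⟩
  · refine outputs_collection (by omega) hfit (htot.trans_lt hnW) (by omega) ?_ r
    have : 2 * d * 2 ^ charBits lg ≤ 2 * d * n := Nat.mul_le_mul_left _ hEn
    rw [hT]
    nlinarith
  · -- the failure probability of the graph
    have hy : ((k : ℝ) ^ 2 / 2 ^ valBits s lg) ^ d ≤ (n : ℝ) ^ (-(c + 2)) := by
      refine (pow_le_pow_left₀ (by positivity)
        (sq_div_two_pow_valBits_le (by omega) (by omega) hkle) d).trans ?_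
      rw [← Real.rpow_natCast, ← Real.rpow_mul hn0.le]
      apply Real.rpow_le_rpow_of_exponent_le h1n
      have h8 : (8 * 2 ^ s : ℝ) ≠ 0 := by positivity
      have : (-(1 / (8 * 2 ^ s)) * (d : ℝ) : ℝ) = -(⌈c⌉₊ + 2) := by
        rw [hd]; push_cast; field_simp
      rw [this]
      linarith [Nat.le_ceil c]
    have hsum : (2 : ℝ) ^ charBits lg * (n : ℝ) ^ (-(c + 2)) ≤ (n : ℝ) ^ (-(c + 1)) := by
      have h1 : (2 : ℝ) ^ charBits lg ≤ n := by exact_mod_cast hEn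
      calc _ ≤ (n : ℝ) * (n : ℝ) ^ (-(c + 2)) := by gcongr
        _ = (n : ℝ) ^ (1 + -(c + 2)) := by rw [Real.rpow_add hn0, Real.rpow_one]
        _ = _ := by congr 1; ring
    have hfail := unifProb_charGraph_le (W := wordLength n w) (T := T)
      ((valBits_le s lg).trans hfit.log) (by rw [hT]; nlinarith [Nat.mul_le_mul_left (2 * d) hEn])
      hy (hsum.trans (Real.rpow_le_one_of_one_le_of_nonpos h1n (by linarith)))
    have hbound : 2 * (2 ^ charBits lg * (n : ℝ) ^ (-(c + 2))) ≤ (n : ℝ) ^ (-c) := by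
      have h2n : (2 : ℝ) ≤ n := by exact_mod_cast (by omega : 2 ≤ n)
      calc _ ≤ (n : ℝ) * (n : ℝ) ^ (-(c + 1)) := by gcongr
        _ = (n : ℝ) ^ (1 + -(c + 1)) := by rw [Real.rpow_add hn0, Real.rpow_one]
        _ = _ := by congr 1; ring
    have hgood := unifProb_add_not fun r : Fin T → BitVec (wordLength n w) =>
      HasUniqueNeighbors k (charGraph (2 * d) (charBits lg) (valBits s lg)
        fun i => extendTape r i)
    refine le_trans (by linarith) (unifProb_mono (p := fun r : Fin T → BitVec (wordLength n w) =>
      HasUniqueNeighbors k (charGraph (2 * d) (charBits lg) (valBits s lg)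
        fun i => extendTape r i)) fun r hr => ?_)
    exact kWiseDependent_graphPerm (by omega) (le_max_left _ _) (le_charBits_mul hn4 hw) hk16' _ hr
  · rw [reprBits_collection]
    exact hrepr
  · exact evaluatedBy_collection hfit (htot.trans hnW.le) r
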